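/- Let $p$ be a prime and let $K$ be a $p$-adic field, i.e. a field of characteristic $0$ that is complete with respect to a non-archimedean absolute value $|\cdot|$ with $|p|<1$ (for example $K=\mathbb{C}_p$). Let $m\ge 1$ be an integer and let $a\in K$, $a\neq 0$. Call a power series over $K$ analytic if its radius of convergence $\rho=(\limsup_n |c_n|^{1/n})^{-1}$ is positive. Write $\sqrt[m]{1-amx^m}\in K[[x]]$ for the unique power series with constant term $1$ (it has the form $1-ax^m+O(x^{m+1})$) whose $m$-th power is $1-amx^m$, and put $$f_{m+1,a}(x)=\frac{x}{\sqrt[m]{1-amx^m}}=x+ax^{m+1}+\cdots .$$ A lipeomorphism is a bijection $h$ such that $h$ and $h^{-1}$ are Lipschitz continuous; two germs $f,g$ fixing $0$ are lipeomorphically equivalent if $f\circ h=h\circ g$ near $0$ for some lipeomorphism $h$ between neighbourhoods of $0$ with $h(0)=0$. Let $f(x)=x+ax^{m+1}+\cdots$ be an analytic power series over $K$ (with no terms of degree strictly between $1$ and $m+1$). Then $f$ is lipeomorphically equivalent to $f_{m+1,a}$. More specifically, for all $\varepsilon>0$ and $0<\delta<\tfrac12$ there are a neighbourhood $X'$ of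 $0$, on which $f$ and $f_{m+1,a}$ are defined and which both of them map into itself, and a bijection $h:X'\to X'$ with $h(0)=0$ and $h^{-1}\circ f\circ h=f_{m+1,a}$ on $X'$, such that, writing $h(x)=x+\bar h(x)$ and $h^{-1}(x)=x+\bar k(x)$, 1. $|\bar h(x)|\le |x|^{m+1-\varepsilon}$ for all $x\in X'$, $x\ne 0$ (and $\bar h(0)=0$); 2. $|\bar h(x_2)-\bar h(x_1)|\le \delta\,|x_2-x_1|$ for all $x_1,x_2\in X'$; 3. $|\bar k(x_2)-\bar k(x_1)|\le \delta\,|x_2-x_1|$ for all $x_1,x_2\in X'$. In particular $h$ is an isometry and a lipeomorphism of $X'$. Consequently, any two analytic power series $f(x)=x+ax^{m+1}+\cdots$ and $g(x)=x+ax^{m+1}+\cdots$ over $K$ with the same $m$ and the same $a\ne 0$ are lipeomorphically equivalent. -/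

import Mathlib

open Filter Topology PowerSeries
open scoped ENNReal NNReal

noncomputable section

namespace PadicGerm

/-! ### Analytic power series -/

section Series

variable {K : Type*} [NormedField K]

/-- The radius of convergence `ρ = (limsup |cₙ|^(1/n))⁻¹` of the power series `∑ cₙ xⁿ`. -/
def radius (F : K⟦X⟧) : ℝ≥0∞ :=
  (limsup (fun n : ℕ => (‖coeff n F‖₊ : ℝ≥0∞) ^ (1 / (n : ℝ))) atTop)⁻¹

/-- The open disk of convergence of a power series. -/
def disk (F : K⟦X⟧) : Set K := {x | (‖x‖₊ : ℝ≥0∞) < radius F}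

/-- The function `x ↦ ∑ cₙ xⁿ`; it is meaningful on `disk F`. -/
def evalAt (F : K⟦X⟧) (x : K) : K := ∑' n : ℕ, coeff n F * x ^ n

/-- `F` is an analytic power series (positive radius of convergence) of the form
`x + a x^(m+1) + ⋯`. -/
structure IsTangentSeries (F : K⟦X⟧) (m : ℕ) (a : K) : Prop where
  radius_pos : 0 < radius F
  coeff_zero : coeff 0 F = 0
  coeff_one : coeff 1 F = 1
  coeff_between : ∀ n, 2 ≤ n → n ≤ m → coeff n F = 0
  coeff_lead : coeff (m + 1) F = a

end Series

/-! ### The flow `f_{m+1,a}` -/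

section Flow

variable {K : Type*} [NormedField K] [CharZero K]

/-- The power series `(1 - a m x^m)^(1/m) = ∑ₖ binom(1/m, k) (-a m)^k x^(m k)`. -/
def rootSeries (m : ℕ) (a : K) : K⟦X⟧ :=
  PowerSeries.mk fun n =>
    if m ∣ n then Ring.choose ((m : K)⁻¹) (n / m) * (-(a * (m : K))) ^ (n / m) else 0

/-- The time-`a` map `f_{m+1,a}(x) = x / (1 - a m x^m)^(1/m)`; it is meaningful on
`flowDomain m a`. -/
def flow (m : ℕ) (a : K) (x : K) : K := x / evalAt (rootSeries m a) x

/-- The points at which `f_{m+1,a}` is defined: the root series converges and does not vanish. -/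
def flowDomain (m : ℕ) (a : K) : Set K :=
  {x | x ∈ disk (rootSeries m a) ∧ evalAt (rootSeries m a) x ≠ 0}

theorem rootSeries_eq (m : ℕ) (hm : m ≠ 0) (a : K) :
    rootSeries m a = PowerSeries.expand m hm
      (PowerSeries.rescale (-(a * (m : K))) (PowerSeries.binomialSeries K ((m : K)⁻¹))) := by
  ext n
  rw [PowerSeries.coeff_expand, rootSeries, PowerSeries.coeff_mk]
  split_ifs with h
  · rw [PowerSeries.coeff_rescale, PowerSeries.binomialSeries_coeff, smul_eq_mul, mul_one, mul_comm]
  · rfl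

/-- `rootSeries m a` is an `m`-th root of `1 - a m x^m`. -/
theorem rootSeries_pow (m : ℕ) (hm : m ≠ 0) (a : K) :
    rootSeries m a ^ m = 1 - C (a * (m : K)) * X ^ m := by
  have key : ∀ k : ℕ, PowerSeries.binomialSeries K ((m : K)⁻¹) ^ k
      = PowerSeries.binomialSeries K ((k : K) * (m : K)⁻¹) := by
    intro k
    induction k with
    | zero => simp
    | succ k ih =>
      rw [pow_succ, ih, ← PowerSeries.binomialSeries_add]
      congr 1
      push_cast
      ring
  have hm' : (m : K) ≠ 0 := by exact_mod_cast hm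
  have h1 : PowerSeries.binomialSeries K ((m : K)⁻¹) ^ m = 1 + X := by
    rw [key, mul_inv_cancel₀ hm']
    have := PowerSeries.binomialSeries_nat (R := K) (A := K) 1
    simpa using this
  rw [rootSeries_eq m hm, ← map_pow, ← map_pow, h1, map_add, map_one, map_add, map_one,
    PowerSeries.rescale_X, map_mul, PowerSeries.expand_C, PowerSeries.expand_X, map_neg]
  ring

theorem rootSeries_coeff_zero (m : ℕ) (a : K) : coeff 0 (rootSeries m a) = 1 := by
  rw [rootSeries, PowerSeries.coeff_mk]
  simp

/-- `rootSeries m a` is `1 - a x^m + O(x^(m+1))`. -/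
theorem rootSeries_coeff_between (m : ℕ) (a : K) (n : ℕ) (h0 : 0 < n) (h : n < m) :
    coeff n (rootSeries m a) = 0 := by
  rw [rootSeries, PowerSeries.coeff_mk, if_neg]
  exact fun hd => absurd (Nat.le_of_dvd h0 hd) (by omega)

theorem rootSeries_coeff_self (m : ℕ) (hm : m ≠ 0) (a : K) :
    coeff m (rootSeries m a) = -a := by
  have hm' : (m : K) ≠ 0 := by exact_mod_cast hm
  rw [rootSeries, PowerSeries.coeff_mk, if_pos dvd_rfl, Nat.div_self (Nat.pos_of_ne_zero hm),
    Ring.choose_one_right, pow_one]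
  field_simp

/-- `rootSeries m a` is the only `m`-th root of `1 - a m x^m` with constant term `1`. -/
theorem eq_rootSeries (m : ℕ) (hm : m ≠ 0) (a : K) (g : K⟦X⟧) (h0 : coeff 0 g = 1)
    (hg : g ^ m = 1 - C (a * (m : K)) * X ^ m) : g = rootSeries m a := by
  have h : (∑ i ∈ Finset.range m, g ^ i * rootSeries m a ^ (m - 1 - i)) *
      (g - rootSeries m a) = 0 := by
    rw [(Commute.all g (rootSeries m a)).geom_sum₂_mul, hg, rootSeries_pow m hm, sub_self]
  rcases mul_eq_zero.mp h with h | h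
  · exfalso
    have h2 := congrArg (constantCoeff (R := K)) h
    have hr := rootSeries_coeff_zero m a
    rw [PowerSeries.coeff_zero_eq_constantCoeff_apply] at h0 hr
    simp [h0, hr, hm] at h2
  · exact sub_eq_zero.mp h

end Flow

/-! ### Lipeomorphisms and lipeomorphic equivalence -/

section Lipeo

variable {K : Type*} [NormedField K]

/-- `h : U → V` is a bijection with inverse `k : V → U`, and both are Lipschitz continuous. -/
structure IsLipeomorphism (h k : K → K) (U V : Set K) : Prop where
  mapsTo : Set.MapsTo h U V
  mapsTo_symm : Set.MapsTo k V U
  invOn : Set.InvOn k h U V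
  lipschitz : ∃ C : ℝ≥0, LipschitzOnWith C h U
  lipschitz_symm : ∃ C : ℝ≥0, LipschitzOnWith C k V

/-- The germs at `0` of `f` and `g` are intertwined by the germ at `0` of a lipeomorphism `h`
between neighbourhoods of `0` with `h 0 = 0`. -/
def LipeomorphicallyEquivalent (f g : K → K) : Prop :=
  ∃ U ∈ 𝓝 (0 : K), ∃ V ∈ 𝓝 (0 : K), ∃ h k : K → K,
    IsLipeomorphism h k U V ∧ h 0 = 0 ∧ ∀ᶠ x in 𝓝 (0 : K), f (h x) = h (g x)

end Lipeo

end PadicGerm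

end

open Filter Topology PowerSeries
open scoped ENNReal NNReal

/-! Near 0, both maps are conjugate to one model that depends only on `m` and `a`; composing one
conjugation with the inverse of the other gives `h`.

Write f = id + g and let x₀ be small, with q = |a||x₀|^m. The relation Δx = g(x) along the orbit,
together with a discrete Leibniz rule, bounds the k-th differences of the orbit by |x₀| q^k
(`diffBounded_orbit`). Division by k! costs at most |p|^(-(k-1)) for k ≥ 1, so for q ≤ η|p| with η <
1 the Newton series of the orbit converges on the unit disk to a function H with H(n) = f^n(x₀) on
the naturals. The identity H(t+1) = f(H(t)) extends from the naturals to the disk, and H(t) differs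
from x₀ + t a x₀^(m+1) by an error that is η-Lipschitz relative to the slope
(`exists_interpolation`).

The balls of radius |a x^(m+1)| around the points x partition a small ball. Choose a centre c in
each and send c + t a c^(m+1) to H_c(t). This map Φ turns the translation by a c^(m+1) into f, and Φ
- id is η-Lipschitz, both inside each ball and between different balls
(`OrbitsInterpolated.exists_conjugation`). The translations do not depend on f. Hence Φ_f ∘ Φ_g⁻¹
conjugates f and g, and it is an isometry with an η-Lipschitz displacement, where η = δ.

Finally, `flow m a` is near 0 the sum of the tangent series X · (root series)⁻¹. -/

namespace PadicGerm

/-! ### Geometric decay of iterated differences. -/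

section Differences

variable {K : Type*} [NormedField K]

/-- The iterated differences of the sequence `s` up to order `k` decay geometrically. -/
def DiffBounded (s : ℕ → K) (M q : ℝ) (k : ℕ) : Prop :=
  ∀ i ≤ k, ∀ n, ‖((fwdDiff 1)^[i] s) n‖ ≤ M * q ^ i

theorem DiffBounded.mono {s : ℕ → K} {M M' q : ℝ} {k : ℕ} (hs : DiffBounded s M q k)
    (hq : 0 ≤ q) (hM : M ≤ M') : DiffBounded s M' q k :=
  fun i hi n => (hs i hi n).trans (by gcongr)

theorem diffBounded_const (c : K) {q : ℝ} (hq : 0 ≤ q) (k : ℕ) :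
    DiffBounded (fun _ => c) ‖c‖ q k := by
  intro i _ n
  rcases i with _ | i
  · simp
  · have h : ((fwdDiff 1)^[i + 1] (fun _ : ℕ => c)) n = 0 := by
      rw [Function.iterate_succ_apply, fwdDiff_const]
      have : ∀ j : ℕ, (fwdDiff 1)^[j] (fun _ : ℕ => (0 : K)) = fun _ => 0 := by
        intro j
        induction j with
        | zero => rfl
        | succ j ih => rw [Function.iterate_succ_apply, fwdDiff_const, ih]
      rw [this]
    rw [h, norm_zero]
    positivity

theorem DiffBounded.of_tendsto {s : ℕ → ℕ → K} {t : ℕ → K} {M q : ℝ} {k : ℕ}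
    (hs : ∀ j, DiffBounded (s j) M q k) (h : ∀ n, Tendsto (fun j => s j n) atTop (𝓝 (t n))) :
    DiffBounded t M q k := by
  intro i hi n
  refine le_of_tendsto (x := atTop) (f := fun j => ‖((fwdDiff 1)^[i] (s j)) n‖) (Tendsto.norm ?_)
    (Eventually.of_forall fun j => hs j i hi n)
  simp only [fwdDiff_iter_eq_sum_shift]
  exact tendsto_finsetSum _ fun l _ => (h _).const_smul _

end Differences

/-! ### Ultrametric calculus of differences, and norms of factorials. -/

section Ultrametric

variable {K : Type*} [NormedField K] [IsUltrametricDist K]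

theorem norm_add_le_of_le {x y : K} {C : ℝ} (hx : ‖x‖ ≤ C) (hy : ‖y‖ ≤ C) : ‖x + y‖ ≤ C :=
  (IsUltrametricDist.norm_add_le_max x y).trans (max_le hx hy)

theorem norm_sub_le_of_le {x y : K} {C : ℝ} (hx : ‖x‖ ≤ C) (hy : ‖y‖ ≤ C) : ‖x - y‖ ≤ C := by
  rw [sub_eq_add_neg]
  exact norm_add_le_of_le hx (by rwa [norm_neg])

theorem norm_eq_of_norm_sub_lt {x y : K} (h : ‖x - y‖ < ‖x‖) : ‖y‖ = ‖x‖ := by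
  refine le_antisymm ?_ ?_
  · have := norm_sub_le_of_le (le_refl ‖x‖) h.le
    simpa using this
  · by_contra! hlt
    have h1 : ‖(x - y) + y‖ ≤ max ‖x - y‖ ‖y‖ := IsUltrametricDist.norm_add_le_max _ _
    rw [sub_add_cancel] at h1
    exact absurd h1 (not_le.mpr (max_lt h hlt))

/-- Induction by the discrete Leibniz rule Δ(st)(n) = Δs(n) t(n+1) + s(n) Δt(n). The ultrametric
inequality keeps binomial coefficients out of the bound. -/
theorem DiffBounded.mul {s t : ℕ → K} {M N q : ℝ} {k : ℕ} (hs : DiffBounded s M q k)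
    (ht : DiffBounded t N q k) : DiffBounded (fun n => s n * t n) (M * N) q k := by
  have key : ∀ i : ℕ, ∀ (s t : ℕ → K) (M N : ℝ), DiffBounded s M q i → DiffBounded t N q i →
      ∀ n, ‖((fwdDiff 1)^[i] (fun n => s n * t n)) n‖ ≤ M * N * q ^ i := by
    intro i
    induction i with
    | zero =>
      intro s t M N hs ht n
      have h1 := hs 0 le_rfl n
      have h2 := ht 0 le_rfl n
      simp only [Function.iterate_zero, id_eq, pow_zero, mul_one, norm_mul] at *
      exact mul_le_mul h1 h2 (norm_nonneg _) ((norm_nonneg _).trans h1)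
    | succ i ih =>
      intro s t M N hs ht n
      have hd : fwdDiff 1 (fun n => s n * t n)
          = (fun n => (fwdDiff 1 s) n * t (n + 1)) + fun n => s n * (fwdDiff 1 t) n := by
        ext n
        simp only [fwdDiff, Pi.add_apply]
        ring
      have hdiff : ∀ (u : ℕ → K) (R : ℝ), DiffBounded u R q (i + 1) →
          DiffBounded (fwdDiff 1 u) (R * q) q i := by
        intro u R hu j hj n
        have := hu (j + 1) (by omega) n
        rw [Function.iterate_succ_apply] at this
        rwa [mul_assoc, ← pow_succ']
      have hle : ∀ (u : ℕ → K) (R : ℝ), DiffBounded u R q (i + 1) → DiffBounded u R q i :=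
        fun u R hu j hj => hu j (by omega)
      have hshift : DiffBounded (fun n => t (n + 1)) N q i := by
        intro j hj n
        rw [fwdDiff_iter_comp_add]
        exact ht j (by omega) _
      rw [Function.iterate_succ_apply, hd, fwdDiff_iter_add, Pi.add_apply]
      refine norm_add_le_of_le ?_ ?_
      · refine (ih _ _ _ _ (hdiff s M hs) hshift n).trans_eq ?_
        ring
      · refine (ih _ _ _ _ (hle s M hs) (hdiff t N ht) n).trans_eq ?_
        ring
  exact fun i hi => key i s t M N (fun j hj => hs j (hj.trans hi)) fun j hj => ht j (hj.trans hi)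

theorem DiffBounded.pow {s : ℕ → K} {M q : ℝ} {k : ℕ} (hs : DiffBounded s M q k) (hq : 0 ≤ q)
    (j : ℕ) : DiffBounded (fun n => s n ^ j) (M ^ j) q k := by
  induction j with
  | zero => simpa using diffBounded_const (1 : K) hq k
  | succ j ih => simpa only [pow_succ] using ih.mul hs

theorem DiffBounded.sum {ι : Type*} (I : Finset ι) {s : ι → ℕ → K} {M q : ℝ} {k : ℕ}
    (hM : 0 ≤ M) (hq : 0 ≤ q) (hs : ∀ i ∈ I, DiffBounded (s i) M q k) :
    DiffBounded (fun n => ∑ i ∈ I, s i n) M q k := by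
  intro j hj n
  have h : (fun n => ∑ i ∈ I, s i n) = ∑ i ∈ I, s i := by
    ext n
    simp
  rw [h, fwdDiff_iter_finsetSum, Finset.sum_apply]
  exact IsUltrametricDist.norm_sum_le_of_forall_le_of_nonneg (by positivity)
    fun i hi => hs i hi j hj n

/-- Substituting a sequence with decaying differences into a polynomial. -/
theorem DiffBounded.polynomial {c : ℕ → K} {s : ℕ → K} {M B q : ℝ} {k : ℕ}
    (hs : DiffBounded s M q k) (hq : 0 ≤ q) (hB : 0 ≤ B) (hc : ∀ j, ‖c j‖ * M ^ j ≤ B) (J : ℕ) :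
    DiffBounded (fun n => ∑ j ∈ Finset.range J, c j * s n ^ j) B q k :=
  DiffBounded.sum _ hB hq fun j _ =>
    ((diffBounded_const (c j) hq k).mul (hs.pow hq j)).mono hq (hc j)

/-- Substituting a sequence with decaying differences into a power series. -/
theorem DiffBounded.powerSeries {c : ℕ → K} {s : ℕ → K} {M B q : ℝ} {k : ℕ}
    (hs : DiffBounded s M q k) (hq : 0 ≤ q) (hB : 0 ≤ B) (hc : ∀ j, ‖c j‖ * M ^ j ≤ B)
    (hsum : ∀ n, Summable fun j => c j * s n ^ j) :
    DiffBounded (fun n => ∑' j, c j * s n ^ j) B q k :=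
  DiffBounded.of_tendsto (fun J => hs.polynomial hq hB hc J)
    fun n => (hsum n).hasSum.tendsto_sum_nat

/-- The k-th difference is a combination of values with integer coefficients, which have norm at
most 1. -/
theorem norm_fwdDiff_iter_le {s : ℕ → K} {k : ℕ} {B : ℝ} (hB : 0 ≤ B)
    (hs : ∀ n ≤ k, ‖s n‖ ≤ B) : ‖((fwdDiff 1)^[k] s) 0‖ ≤ B := by
  rw [fwdDiff_iter_eq_sum_shift]
  refine IsUltrametricDist.norm_sum_le_of_forall_le_of_nonneg hB fun i hi => ?_
  rw [zsmul_eq_mul, norm_mul]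
  have h1 := IsUltrametricDist.norm_intCast_le_one K ((-1) ^ (k - i) * (k.choose i : ℤ))
  have h2 := hs i (by simpa [Nat.lt_succ_iff] using hi)
  simp only [nsmul_eq_mul, mul_one, zero_add, Nat.cast_id]
  calc _ ≤ 1 * B := by gcongr
    _ = B := one_mul B

section Factorial

variable {p : ℕ}

theorem norm_natCast_eq_one_of_coprime (hpK : ‖(p : K)‖ < 1) {n : ℕ} (h : n.Coprime p) :
    ‖(n : K)‖ = 1 := by
  refine le_antisymm (IsUltrametricDist.norm_natCast_le_one K n) ?_
  by_contra! hlt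
  have hb : (n : ℤ) * n.gcdA p + p * n.gcdB p = 1 := by
    rw [← Nat.gcd_eq_gcd_ab, h.gcd_eq_one, Nat.cast_one]
  have h1 : (n : K) * (n.gcdA p : ℤ) + p * (n.gcdB p : ℤ) = 1 := by
    have := congrArg (Int.cast (R := K)) hb
    push_cast at this
    exact this
  have h2 : ‖(n : K) * (n.gcdA p : ℤ) + p * (n.gcdB p : ℤ)‖ ≤ max ‖(n : K)‖ ‖(p : K)‖ := by
    refine (IsUltrametricDist.norm_add_le_max _ _).trans (max_le_max ?_ ?_) <;>
    · rw [norm_mul]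
      exact mul_le_of_le_one_right (norm_nonneg _) (IsUltrametricDist.norm_intCast_le_one K _)
  rw [h1, norm_one] at h2
  exact absurd h2 (not_le.mpr (max_lt hlt hpK))

theorem norm_natCast_eq (hp : p.Prime) (hpK : ‖(p : K)‖ < 1) {n : ℕ} (hn : n ≠ 0) :
    ‖(n : K)‖ = ‖(p : K)‖ ^ padicValNat p n := by
  have := Fact.mk hp
  obtain ⟨v, l, hl, h⟩ := Nat.exists_eq_pow_mul_and_not_dvd hn p hp.ne_one
  have hl0 : l ≠ 0 := by rintro rfl; simp at hl
  rw [h, padicValNat.mul (pow_ne_zero _ hp.ne_zero) hl0, padicValNat.prime_pow,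
    padicValNat.eq_zero_of_not_dvd hl, add_zero]
  push_cast
  rw [norm_mul, norm_pow, norm_natCast_eq_one_of_coprime hpK
    ((Nat.Prime.coprime_iff_not_dvd hp).mpr hl).symm, mul_one]

theorem pow_le_norm_factorial (hp : p.Prime) (hpK : ‖(p : K)‖ < 1) (k : ℕ) :
    ‖(p : K)‖ ^ k ≤ ‖(k.factorial : K)‖ := by
  have := Fact.mk hp
  rw [norm_natCast_eq hp hpK k.factorial_ne_zero]
  exact pow_le_pow_of_le_one (norm_nonneg _) hpK.le (padicValNat_factorial_le (p := p) k)

/-- Legendre's strict bound v_p(n!) < n for n > 0. The power of p saved over `pow_le_norm_factorial`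
keeps a full factor q in the Newton coefficients, so errors are measured on the scale of the slope.
-/
theorem pow_le_norm_factorial_succ (hp : p.Prime) (hpK : ‖(p : K)‖ < 1) (k : ℕ) :
    ‖(p : K)‖ ^ k ≤ ‖((k + 1).factorial : K)‖ := by
  have := Fact.mk hp
  rw [norm_natCast_eq hp hpK (k + 1).factorial_ne_zero]
  exact pow_le_pow_of_le_one (norm_nonneg _) hpK.le
    (Nat.lt_succ_iff.mp (padicValNat_factorial_lt_of_ne_zero p k.succ_ne_zero))

end Factorial

end Ultrametric

/-! ### Newton interpolation on the natural numbers. -/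

section Newton

variable {K : Type*} [NormedField K]

/-- The Newton series `∑_{k < N} d k * binom(X, k)`. -/
noncomputable def newtonSum (d : ℕ → K) (N : ℕ) : Polynomial K :=
  ∑ k ∈ Finset.range N, Polynomial.C (d k / (k.factorial : K)) * descPochhammer K k

theorem eval_newtonSum (d : ℕ → K) (N : ℕ) (t : K) : (newtonSum d N).eval t =
    ∑ k ∈ Finset.range N, d k / (k.factorial : K) * (descPochhammer K k).eval t := by
  simp [newtonSum, Polynomial.eval_finsetSum]

theorem eval_natCast_newtonSum [CharZero K] (d : ℕ → K) (N n : ℕ) :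
    (newtonSum d N).eval (n : K) = ∑ k ∈ Finset.range N, d k * (n.choose k : K) := by
  rw [eval_newtonSum]
  refine Finset.sum_congr rfl fun k _ => ?_
  rw [descPochhammer_eval_eq_descFactorial, Nat.descFactorial_eq_factorial_mul_choose]
  have : (k.factorial : K) ≠ 0 := by exact_mod_cast k.factorial_ne_zero
  push_cast
  field_simp

theorem eval_natCast_newtonSum_fwdDiff [CharZero K] (s : ℕ → K) {n N : ℕ} (h : n < N) :
    (newtonSum (fun k => (fwdDiff 1)^[k] s 0) N).eval (n : K) = s n := by
  rw [eval_natCast_newtonSum]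
  have h1 := shift_eq_sum_fwdDiff_iter 1 s n 0
  simp only [nsmul_eq_mul, mul_one, zero_add, Nat.cast_id] at h1
  rw [h1]
  symm
  simp only [mul_comm]
  refine Finset.sum_subset (by simpa using h) fun k _ hk => ?_
  rw [Nat.choose_eq_zero_of_lt (by simpa using hk), Nat.cast_zero, zero_mul]

theorem natDegree_newtonSum_lt (d : ℕ → K) {N : ℕ} (hN : 0 < N) :
    (newtonSum d N).natDegree < N := by
  refine (Polynomial.natDegree_sum_le _ _).trans_lt ?_
  rw [Finset.fold_max_lt]
  refine ⟨hN, fun k hk => ?_⟩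
  refine (Polynomial.natDegree_C_mul_le _ _).trans_lt ?_
  rw [descPochhammer_natDegree]
  simpa using hk

/-- Newton's interpolation formula. -/
theorem newtonSum_eq [CharZero K] (Q : Polynomial K) {N : ℕ} (h : Q.natDegree < N) :
    newtonSum (fun k => (fwdDiff 1)^[k] (fun n : ℕ => Q.eval (n : K)) 0) N = Q := by
  refine Polynomial.eq_of_degrees_lt_of_eval_index_eq (s := Finset.range N)
    (v := fun n : ℕ => (n : K)) (Nat.cast_injective.injOn) ?_ ?_ ?_
  · rw [Finset.card_range]
    exact Polynomial.degree_le_natDegree.trans_lt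
      (by exact_mod_cast natDegree_newtonSum_lt _ (by omega))
  · rw [Finset.card_range]
    exact Polynomial.degree_le_natDegree.trans_lt (by exact_mod_cast h)
  · intro n hn
    exact eval_natCast_newtonSum_fwdDiff _ (by simpa using hn)

/-- Differencing turns binom(n, k+1) into binom(n, k), so each difference moves one factor q from
the coefficient to the bound. Hence truncated Newton sums inherit the decay of the full sequence. -/
theorem diffBounded_choose (i k : ℕ) {d : K} {R q : ℝ} (hR : 0 ≤ R) (hq : 0 ≤ q) (hq1 : q ≤ 1)
    (hK : ∀ n : ℕ, ‖(n : K)‖ ≤ 1) (hd : ‖d‖ ≤ R * q ^ k) (n : ℕ) :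
    ‖(fwdDiff 1)^[i] (fun n : ℕ => d * (n.choose k : K)) n‖ ≤ R * q ^ i := by
  induction i generalizing k R with
  | zero =>
    simp only [Function.iterate_zero, id_eq, pow_zero, mul_one, norm_mul]
    calc _ ≤ R * q ^ k * 1 := by gcongr; exact hK _
      _ ≤ R * 1 * 1 := by gcongr; exact pow_le_one₀ hq hq1
      _ = R := by ring
  | succ i ih =>
    rcases k with _ | k
    · have := diffBounded_const d hq (i + 1) (i + 1) le_rfl n
      simp only [Nat.choose_zero_right, Nat.cast_one, mul_one]
      refine this.trans ?_
      gcongr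
      simpa using hd
    · have h : fwdDiff 1 (fun n : ℕ => d * (n.choose (k + 1) : K))
          = fun n : ℕ => d * (n.choose k : K) := by
        ext n
        simp only [fwdDiff, Nat.choose_succ_succ']
        push_cast
        ring
      rw [Function.iterate_succ_apply, h]
      refine (ih k (R := R * q) (by positivity) ?_).trans_eq (by ring)
      rw [mul_assoc, ← pow_succ']
      exact hd

variable [IsUltrametricDist K]

theorem norm_eval_descPochhammer_le {t : K} (ht : ‖t‖ ≤ 1) (k : ℕ) :
    ‖(descPochhammer K k).eval t‖ ≤ 1 := by
  induction k with
  | zero => simp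
  | succ k ih =>
    rw [descPochhammer_succ_eval, norm_mul]
    exact mul_le_one₀ ih (norm_nonneg _)
      (norm_sub_le_of_le ht (IsUltrametricDist.norm_natCast_le_one K k))

theorem norm_eval_descPochhammer_sub_le {t u : K} (ht : ‖t‖ ≤ 1) (hu : ‖u‖ ≤ 1) (k : ℕ) :
    ‖(descPochhammer K k).eval t - (descPochhammer K k).eval u‖ ≤ ‖t - u‖ := by
  induction k with
  | zero => simp
  | succ k ih =>
    rw [descPochhammer_succ_eval, descPochhammer_succ_eval]
    have h : (descPochhammer K k).eval t * (t - k) - (descPochhammer K k).eval u * (u - k)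
        = (descPochhammer K k).eval t * (t - u)
          + ((descPochhammer K k).eval t - (descPochhammer K k).eval u) * (u - k) := by ring
    rw [h]
    refine norm_add_le_of_le ?_ ?_
    · rw [norm_mul]
      exact mul_le_of_le_one_left (norm_nonneg _) (norm_eval_descPochhammer_le ht k)
    · rw [norm_mul]
      exact (mul_le_of_le_one_right (norm_nonneg _)
        (norm_sub_le_of_le hu (IsUltrametricDist.norm_natCast_le_one K k))).trans ih

/-- By the exact Newton formula for polynomials, control on the naturals passes to the whole unit
disk. The decay |p|^k pays for the division by k!. -/
theorem norm_eval_le_of_fwdDiff [CharZero K] {p : ℕ} (hp : p.Prime) (hpK : ‖(p : K)‖ < 1)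
    (Q : Polynomial K) {B : ℝ} (hB : 0 ≤ B)
    (h : ∀ k, ‖(fwdDiff 1)^[k] (fun n : ℕ => Q.eval (n : K)) 0‖ ≤ B * ‖(p : K)‖ ^ k) {t : K}
    (ht : ‖t‖ ≤ 1) : ‖Q.eval t‖ ≤ B := by
  rw [← newtonSum_eq Q (Nat.lt_succ_self _), eval_newtonSum]
  refine IsUltrametricDist.norm_sum_le_of_forall_le_of_nonneg hB fun k _ => ?_
  have hk : 0 < ‖(k.factorial : K)‖ := by
    rw [norm_pos_iff]
    exact_mod_cast k.factorial_ne_zero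
  rw [norm_mul, norm_div]
  refine (mul_le_of_le_one_right (by positivity) (norm_eval_descPochhammer_le ht k)).trans ?_
  rw [div_le_iff₀ hk]
  exact (h k).trans (by gcongr; exact pow_le_norm_factorial hp hpK k)

end Newton

/-! ### Differences along an orbit. -/

section Orbit

variable {K : Type*} [NormedField K] [IsUltrametricDist K]

theorem DiffBounded.add {s t : ℕ → K} {M q : ℝ} {k : ℕ} (hs : DiffBounded s M q k)
    (ht : DiffBounded t M q k) : DiffBounded (fun n => s n + t n) M q k := by
  intro i hi n
  have h : (fun n => s n + t n) = s + t := rfl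
  rw [h, fwdDiff_iter_add]
  exact norm_add_le_of_le (hs i hi n) (ht i hi n)

theorem DiffBounded.sub {s t : ℕ → K} {M q : ℝ} {k : ℕ} (hs : DiffBounded s M q k)
    (ht : DiffBounded t M q k) : DiffBounded (fun n => s n - t n) M q k := by
  intro i hi n
  have h : (fun n => s n - t n) = s + (-1 : ℤ) • t := by
    ext n
    simp [sub_eq_add_neg]
  rw [h, fwdDiff_iter_add, fwdDiff_iter_const_smul]
  refine norm_add_le_of_le (hs i hi n) ?_
  simpa using ht i hi n

/-- The extra factor ρ on both sides avoids the exponent j - 1, so j = 0 needs no exception. -/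
theorem norm_pow_sub_pow_mul_le {u v : K} {ρ : ℝ} (hu : ‖u‖ ≤ ρ) (hv : ‖v‖ ≤ ρ) (j : ℕ) :
    ‖u ^ j - v ^ j‖ * ρ ≤ ρ ^ j * ‖u - v‖ := by
  have hρ : 0 ≤ ρ := (norm_nonneg u).trans hu
  induction j with
  | zero => simp
  | succ j ih =>
    have h : u ^ (j + 1) - v ^ (j + 1) = u ^ j * (u - v) + (u ^ j - v ^ j) * v := by ring
    have hle : ‖u ^ (j + 1) - v ^ (j + 1)‖ ≤ ρ ^ j * ‖u - v‖ := by
      rw [h]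
      refine norm_add_le_of_le ?_ ?_
      · rw [norm_mul, norm_pow]
        gcongr
      · rw [norm_mul]
        exact le_trans (by gcongr) ih
    calc _ ≤ ρ ^ j * ‖u - v‖ * ρ := by gcongr
      _ = _ := by ring

theorem norm_tsum_pow_le {c : ℕ → K} {u : K} {ρ B : ℝ} (hB : 0 ≤ B) (hu : ‖u‖ ≤ ρ)
    (hc : ∀ j, ‖c j‖ * ρ ^ j ≤ B) : ‖∑' j, c j * u ^ j‖ ≤ B := by
  refine IsUltrametricDist.norm_tsum_le_of_forall_le_of_nonneg hB fun j => ?_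
  rw [norm_mul, norm_pow]
  exact le_trans (by gcongr) (hc j)

theorem norm_tsum_pow_sub_le {c : ℕ → K} {u v : K} {ρ q : ℝ} (hu : ‖u‖ ≤ ρ) (hv : ‖v‖ ≤ ρ)
    (hq : 0 ≤ q) (hc : ∀ j, ‖c j‖ * ρ ^ j ≤ q * ρ)
    (hsum : ∀ u : K, ‖u‖ ≤ ρ → Summable fun j => c j * u ^ j) :
    ‖∑' j, c j * u ^ j - ∑' j, c j * v ^ j‖ ≤ q * ‖u - v‖ := by
  have hρ : 0 ≤ ρ := (norm_nonneg u).trans hu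
  rcases hρ.eq_or_lt with rfl | hρ
  · rw [norm_le_zero_iff.mp hu, norm_le_zero_iff.mp hv]
    simp
  rw [← (hsum u hu).tsum_sub (hsum v hv)]
  refine IsUltrametricDist.norm_tsum_le_of_forall_le_of_nonneg (by positivity) fun j => ?_
  rw [← mul_sub, norm_mul]
  refine le_of_mul_le_mul_right ?_ hρ
  calc ‖c j‖ * ‖u ^ j - v ^ j‖ * ρ = ‖c j‖ * (‖u ^ j - v ^ j‖ * ρ) := by ring
    _ ≤ ‖c j‖ * (ρ ^ j * ‖u - v‖) :=
      mul_le_mul_of_nonneg_left (norm_pow_sub_pow_mul_le hu hv j) (norm_nonneg _)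
    _ = ‖c j‖ * ρ ^ j * ‖u - v‖ := by ring
    _ ≤ q * ρ * ‖u - v‖ := mul_le_mul_of_nonneg_right (hc j) (norm_nonneg _)
    _ = _ := by ring

/-- The differences of an orbit of a map `x + ∑ c j x ^ j` close to the identity. -/
theorem diffBounded_orbit {c x : ℕ → K} {ρ q : ℝ} (hρ : 0 ≤ ρ) (hq : 0 ≤ q) (hq1 : q ≤ 1)
    (hc : ∀ j, ‖c j‖ * ρ ^ j ≤ q * ρ)
    (hsum : ∀ u : K, ‖u‖ ≤ ρ → Summable fun j => c j * u ^ j) (hx0 : ‖x 0‖ ≤ ρ)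
    (hx : ∀ n, x (n + 1) = x n + ∑' j, c j * x n ^ j) (k : ℕ) : DiffBounded x ρ q k := by
  have hqρ : q * ρ ≤ ρ := mul_le_of_le_one_left hρ hq1
  have hball : ∀ n, ‖x n‖ ≤ ρ := by
    intro n
    induction n with
    | zero => exact hx0
    | succ n ih =>
      rw [hx]
      exact norm_add_le_of_le ih ((norm_tsum_pow_le (by positivity) ih hc).trans hqρ)
  induction k with
  | zero =>
    intro i hi n
    obtain rfl : i = 0 := by omega
    simpa using hball n
  | succ k ih =>
    -- Bootstrap: Δx is the power series in x, whose terms are bounded by qρ, so bounds up to order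
    -- k on x give bounds up to order k + 1.
    have h := ih.powerSeries hq (by positivity) hc fun n => hsum _ (hball n)
    intro i hi n
    rcases i with _ | i
    · simpa using hball n
    · have hd : fwdDiff 1 x = fun n => ∑' j, c j * x n ^ j := by
        ext n
        simp [fwdDiff, hx]
      rw [Function.iterate_succ_apply, hd]
      refine (h i (by omega) n).trans_eq ?_
      ring

end Orbit

/-! ### Interpolation of an orbit by a function on the unit disk. -/

section Interpolation

variable {K : Type*} [NormedField K] [IsUltrametricDist K] [CharZero K]

theorem norm_fwdDiff_div_factorial_le {p : ℕ} (hp : p.Prime) (hpK : ‖(p : K)‖ < 1) {x : ℕ → K}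
    {ρ q η : ℝ} (hρ : 0 ≤ ρ) (hq : 0 ≤ q) (hqη : q ≤ η * ‖(p : K)‖)
    (hx : ∀ k, DiffBounded x ρ q k) (k : ℕ) :
    ‖(fwdDiff 1)^[k + 1] x 0 / ((k + 1).factorial : K)‖ ≤ ρ * q * η ^ k := by
  have hk : 0 < ‖((k + 1).factorial : K)‖ := by
    rw [norm_pos_iff]
    exact_mod_cast (k + 1).factorial_ne_zero
  rw [norm_div, div_le_iff₀ hk]
  have hp0 : 0 < ‖(p : K)‖ := by
    rw [norm_pos_iff]
    exact_mod_cast hp.ne_zero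
  have hη : 0 ≤ η := nonneg_of_mul_nonneg_left (hq.trans hqη) hp0
  calc _ ≤ ρ * q ^ (k + 1) := hx (k + 1) (k + 1) le_rfl 0
    _ = ρ * q * q ^ k := by ring
    _ ≤ ρ * q * (η * ‖(p : K)‖) ^ k := by gcongr
    _ = ρ * q * η ^ k * ‖(p : K)‖ ^ k := by ring
    _ ≤ _ := by gcongr; exact pow_le_norm_factorial_succ hp hpK k

/-- The partial Newton sums of an orbit nearly satisfy the functional equation of the orbit. -/
theorem norm_newtonSum_functionalEquation_le {p : ℕ} (hp : p.Prime) (hpK : ‖(p : K)‖ < 1)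
    {c x : ℕ → K} {ρ q η : ℝ} (hρ : 0 ≤ ρ) (hq : 0 ≤ q) (hη : η < 1) (hqη : q ≤ η * ‖(p : K)‖)
    (hc : ∀ j, ‖c j‖ * ρ ^ j ≤ q * ρ)
    (hsum : ∀ u : K, ‖u‖ ≤ ρ → Summable fun j => c j * u ^ j) (hball : ∀ n, ‖x n‖ ≤ ρ)
    (hx : ∀ n, x (n + 1) = x n + ∑' j, c j * x n ^ j) (hdiff : ∀ k, DiffBounded x ρ q k)
    (N : ℕ) {t : K} (ht : ‖t‖ ≤ 1) {P : Polynomial K}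
    (hP : P = newtonSum (fun k => (fwdDiff 1)^[k] x 0) (N + 1)) (hPt : ‖P.eval t‖ ≤ ρ) :
    ‖P.eval (t + 1) - (P.eval t + ∑' j, c j * P.eval t ^ j)‖ ≤ ρ * η ^ N := by
  have hp0 : 0 < ‖(p : K)‖ := by
    rw [norm_pos_iff]
    exact_mod_cast hp.ne_zero
  have hη0 : 0 ≤ η := nonneg_of_mul_nonneg_left (hq.trans hqη) hp0
  have hq1 : q ≤ 1 := hqη.trans (mul_le_one₀ hη.le hp0.le hpK.le)
  have hqρ : q * ρ ≤ ρ := mul_le_of_le_one_left hρ hq1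
  -- The defect of the functional equation, with the power series cut at J so that it is a
  -- polynomial and Newton's formula is exact.
  let Q : ℕ → Polynomial K := fun J => P.comp (Polynomial.X + 1) -
    (P + ∑ j ∈ Finset.range J, Polynomial.C (c j) * P ^ j)
  have hQ : ∀ J u, (Q J).eval u = P.eval (u + 1) -
      (P.eval u + ∑ j ∈ Finset.range J, c j * P.eval u ^ j) := by
    intro J u
    simp [Q, Polynomial.eval_finsetSum]
  have hPd : ∀ k, DiffBounded (fun n : ℕ => P.eval (n : K)) ρ q k := by
    intro k
    simp only [hP, eval_natCast_newtonSum]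
    refine DiffBounded.sum _ hρ hq fun l _ i _ n => ?_
    exact diffBounded_choose i l hρ hq hq1 (IsUltrametricDist.norm_natCast_le_one K)
      (hdiff l l le_rfl 0) n
  have hQd : ∀ J k, DiffBounded (fun n : ℕ => (Q J).eval (n : K)) ρ q k := by
    intro J k
    simp only [hQ]
    refine DiffBounded.sub ?_ ((hPd k).add ?_)
    · intro i hi n
      have := fwdDiff_iter_comp_add (h := 1) (fun n : ℕ => P.eval (n : K)) 1 i n
      push_cast at this
      rw [this]
      exact hPd k i hi _
    · exact ((hPd k).polynomial hq (by positivity) hc J).mono hq hqρ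
  have hPn : ∀ n < N + 1, P.eval (n : K) = x n := by
    intro n hn
    rw [hP]
    exact eval_natCast_newtonSum_fwdDiff _ hn
  refine le_of_forall_pos_le_add fun τ hτ => ?_
  have hlim : Tendsto (fun J => ‖(Q J).eval t‖) atTop
      (𝓝 ‖P.eval (t + 1) - (P.eval t + ∑' j, c j * P.eval t ^ j)‖) := by
    simp only [hQ]
    exact ((hsum _ hPt).hasSum.tendsto_sum_nat.const_add _ |>.const_sub _).norm
  -- P agrees with the orbit at 0, ..., N, so the defect at n < N tends to 0 with J. The factor
  -- |p|^N makes it at most τ|p|^k for every k < N.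
  have hsmall : ∀ᶠ J in atTop, ∀ n < N, ‖(Q J).eval (n : K)‖ ≤ τ * ‖(p : K)‖ ^ N := by
    refine (eventually_all_finite (Set.finite_Iio N)).mpr fun n (hn : n < N) => ?_
    have hlimn : Tendsto (fun J => ‖(Q J).eval (n : K)‖) atTop (𝓝 0) := by
      have h1 := ((hsum _ (hball n)).hasSum.tendsto_sum_nat.const_add (x n)
        |>.const_sub (x (n + 1))).norm
      rw [← hx, sub_self, norm_zero] at h1
      refine h1.congr fun J => ?_
      rw [hQ, hPn n (by omega)]
      have := hPn (n + 1) (by omega)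
      push_cast at this
      rw [this]
    exact hlimn.eventually_le_const (by positivity)
  refine le_of_tendsto hlim ?_
  filter_upwards [hsmall] with J hJ
  refine norm_eval_le_of_fwdDiff hp hpK (Q J) (by positivity) (fun k => ?_) ht
  -- Orders below N see only the nearly vanishing values; orders from N on are controlled by q^k,
  -- which yields η^N.
  rcases lt_or_ge k N with hk | hk
  · refine (norm_fwdDiff_iter_le (B := τ * ‖(p : K)‖ ^ N) (by positivity)
      fun n hn => hJ n (by omega)).trans ?_
    have h1 : ‖(p : K)‖ ^ N ≤ ‖(p : K)‖ ^ k := pow_le_pow_of_le_one hp0.le hpK.le hk.le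
    have h2 : 0 ≤ ρ * η ^ N := by positivity
    gcongr
    linarith
  · calc _ ≤ ρ * q ^ k := hQd J k k le_rfl 0
      _ ≤ ρ * (η * ‖(p : K)‖) ^ k := by gcongr
      _ = ρ * η ^ k * ‖(p : K)‖ ^ k := by ring
      _ ≤ ρ * η ^ N * ‖(p : K)‖ ^ k := by
        gcongr ρ * ?_ * _
        exact pow_le_pow_of_le_one hη0 hη.le hk
      _ ≤ _ := by
        gcongr
        linarith

/-- The orbit of a point under a map `x + ∑ c j x ^ j` close to the identity is interpolated on the
closed unit disk by a function which is nearly affine. -/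
theorem exists_interpolation [CompleteSpace K] {p : ℕ} (hp : p.Prime) (hpK : ‖(p : K)‖ < 1)
    {c : ℕ → K} {ρ q η : ℝ} (hq : 0 ≤ q) (hη : η < 1) (hqη : q ≤ η * ‖(p : K)‖)
    (hc : ∀ j, ‖c j‖ * ρ ^ j ≤ q * ρ)
    (hsum : ∀ u : K, ‖u‖ ≤ ρ → Summable fun j => c j * u ^ j) {x₀ : K} (hx₀ : ‖x₀‖ ≤ ρ) :
    ∃ H : K → K, H 0 = x₀ ∧ (∀ t, ‖t‖ ≤ 1 → ‖H t‖ ≤ ρ) ∧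
      (∀ t u, ‖t‖ ≤ 1 → ‖u‖ ≤ 1 →
        ‖(H t - t * ∑' j, c j * x₀ ^ j) - (H u - u * ∑' j, c j * x₀ ^ j)‖
          ≤ η * (q * ρ) * ‖t - u‖) ∧
      ∀ t, ‖t‖ ≤ 1 → H (t + 1) = H t + ∑' j, c j * H t ^ j := by
  have hρ : 0 ≤ ρ := (norm_nonneg _).trans hx₀
  have hp0 : 0 < ‖(p : K)‖ := by
    rw [norm_pos_iff]
    exact_mod_cast hp.ne_zero
  have hη0 : 0 ≤ η := nonneg_of_mul_nonneg_left (hq.trans hqη) hp0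
  have hq1 : q ≤ 1 := hqη.trans (mul_le_one₀ hη.le hp0.le hpK.le)
  have hqρ : q * ρ ≤ ρ := mul_le_of_le_one_left hρ hq1
  let x : ℕ → K := fun n => (fun u => u + ∑' j, c j * u ^ j)^[n] x₀
  have hx : ∀ n, x (n + 1) = x n + ∑' j, c j * x n ^ j :=
    fun n => Function.iterate_succ_apply' _ _ _
  have hdiff : ∀ k, DiffBounded x ρ q k := diffBounded_orbit hρ hq hq1 hc hsum hx₀ hx
  have hball : ∀ n, ‖x n‖ ≤ ρ := fun n => by simpa using hdiff 0 0 le_rfl n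
  let e : ℕ → K := fun k => (fwdDiff 1)^[k] x 0 / (k.factorial : K)
  have he : ∀ k, ‖e (k + 1)‖ ≤ ρ * q * η ^ k :=
    norm_fwdDiff_div_factorial_le hp hpK hρ hq hqη hdiff
  have he0 : e 0 = x₀ := by simp [e, x]
  have he1 : e 1 = ∑' j, c j * x₀ ^ j := by simp [e, fwdDiff, x]
  have heρ : ∀ k, ‖e k‖ ≤ ρ := by
    rintro (_ | k)
    · rwa [he0]
    · refine (he k).trans ?_
      calc _ ≤ ρ * 1 * 1 := by gcongr; exact pow_le_one₀ hη0 hη.le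
        _ = ρ := by ring
  have hsummable : ∀ t : K, ‖t‖ ≤ 1 → Summable fun k => e k * (descPochhammer K k).eval t := by
    intro t ht
    rw [← summable_nat_add_iff 1]
    refine Summable.of_norm_bounded ((summable_geometric_of_lt_one hη0 hη).mul_left (ρ * q))
      fun k => ?_
    rw [norm_mul]
    exact (mul_le_of_le_one_right (norm_nonneg _) (norm_eval_descPochhammer_le ht _)).trans (he k)
  let H : K → K := fun t => ∑' k, e k * (descPochhammer K k).eval t
  have hH : ∀ t : K, ‖t‖ ≤ 1 → HasSum (fun k => e k * (descPochhammer K k).eval t) (H t) :=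
    fun t ht => (hsummable t ht).hasSum
  have hHρ : ∀ t : K, ‖t‖ ≤ 1 → ‖H t‖ ≤ ρ := by
    intro t ht
    refine IsUltrametricDist.norm_tsum_le_of_forall_le_of_nonneg hρ fun k => ?_
    rw [norm_mul]
    exact (mul_le_of_le_one_right (norm_nonneg _) (norm_eval_descPochhammer_le ht k)).trans
      (heρ k)
  refine ⟨H, ?_, hHρ, ?_, ?_⟩
  · have h : ∀ k ≠ 0, e k * (descPochhammer K k).eval 0 = 0 := by
      intro k hk
      rw [descPochhammer_ne_zero_eval_zero K hk, mul_zero]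
    rw [show H 0 = _ from tsum_eq_single 0 h]
    simp [he0]
  · intro t u ht hu
    rw [← he1]
    have h := ((hH t ht).sub (hasSum_ite_eq 1 (t * e 1))).sub
      ((hH u hu).sub (hasSum_ite_eq 1 (u * e 1)))
    rw [← h.tsum_eq]
    refine IsUltrametricDist.norm_tsum_le_of_forall_le_of_nonneg (by positivity) ?_
    -- The constant terms cancel and the linear ones are subtracted. From degree 2 on each
    -- coefficient carries at least one factor η, and falling factorials are 1-Lipschitz on the unit
    -- disk.
    rintro (_ | _ | k)
    · simp
      positivity
    · simp [mul_comm]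
      positivity
    · have h2 : e (k + 2) * (descPochhammer K (k + 2)).eval t - 0
          - (e (k + 2) * (descPochhammer K (k + 2)).eval u - 0) = e (k + 2) *
          ((descPochhammer K (k + 2)).eval t - (descPochhammer K (k + 2)).eval u) := by ring
      simp only [show k + 1 + 1 = k + 2 from rfl, show ¬ (k + 2 = 1) by omega, if_false]
      rw [h2, norm_mul]
      refine mul_le_mul ?_ (norm_eval_descPochhammer_sub_le ht hu _) (norm_nonneg _)
        (by positivity)
      calc _ ≤ ρ * q * η ^ (k + 1) := he (k + 1)
        _ = η * (q * ρ) * η ^ k := by ring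
        _ ≤ η * (q * ρ) * 1 := by gcongr; exact pow_le_one₀ hη0 hη.le
        _ = _ := mul_one _
  · intro t ht
    have ht1 : ‖t + 1‖ ≤ 1 := norm_add_le_of_le ht norm_one.le
    let P : ℕ → Polynomial K := fun N => newtonSum (fun k => (fwdDiff 1)^[k] x 0) (N + 1)
    have hPeval : ∀ N u, (P N).eval u
        = ∑ k ∈ Finset.range (N + 1), e k * (descPochhammer K k).eval u :=
      fun N u => eval_newtonSum _ _ _
    have hPlim : ∀ u : K, ‖u‖ ≤ 1 → Tendsto (fun N => (P N).eval u) atTop (𝓝 (H u)) := by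
      intro u hu
      simp only [hPeval]
      exact (hH u hu).tendsto_sum_nat.comp (tendsto_add_atTop_nat 1)
    have hPρ : ∀ N, ‖(P N).eval t‖ ≤ ρ := by
      intro N
      rw [hPeval]
      refine IsUltrametricDist.norm_sum_le_of_forall_le_of_nonneg hρ fun k _ => ?_
      rw [norm_mul]
      exact (mul_le_of_le_one_right (norm_nonneg _) (norm_eval_descPochhammer_le ht k)).trans
        (heρ k)
    have hg : Tendsto (fun N => ∑' j, c j * (P N).eval t ^ j) atTop
        (𝓝 (∑' j, c j * H t ^ j)) := by
      rw [tendsto_iff_norm_sub_tendsto_zero]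
      refine squeeze_zero (fun _ => norm_nonneg _)
        (fun N => norm_tsum_pow_sub_le (hPρ N) (hHρ t ht) hq hc hsum) ?_
      have := ((hPlim t ht).sub_const (H t)).norm.const_mul q
      simpa using this
    have hz : Tendsto (fun N => ρ * η ^ N) atTop (𝓝 0) := by
      simpa using (tendsto_pow_atTop_nhds_zero_of_lt_one hη0 hη).const_mul ρ
    -- The defect of the N-th partial sum is at most ρη^N, so it vanishes in the limit.
    have hle := le_of_tendsto_of_tendsto
      ((hPlim _ ht1).sub ((hPlim t ht).add hg)).norm hz (Eventually.of_forall fun N =>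
        norm_newtonSum_functionalEquation_le hp hpK hρ hq hη hqη hc hsum hball hx hdiff N ht rfl
          (hPρ N))
    exact sub_eq_zero.mp (norm_le_zero_iff.mp hle)

end Interpolation

/-! ### Contractive perturbations of the identity. -/

section Perturbation

variable {K : Type*} [NormedField K] [IsUltrametricDist K]

theorem norm_sub_eq_of_perturbation {Φ : K → K} {s : Set K} {η : ℝ} (hη : η < 1)
    (hΦ : ∀ x ∈ s, ∀ y ∈ s, ‖(Φ x - x) - (Φ y - y)‖ ≤ η * ‖x - y‖) {x y : K} (hx : x ∈ s)
    (hy : y ∈ s) : ‖Φ x - Φ y‖ = ‖x - y‖ := by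
  rcases eq_or_ne x y with rfl | hxy
  · simp
  have hpos : 0 < ‖x - y‖ := norm_pos_iff.mpr (sub_ne_zero.mpr hxy)
  refine norm_eq_of_norm_sub_lt ?_
  rw [show x - y - (Φ x - Φ y) = -((Φ x - x) - (Φ y - y)) by ring, norm_neg]
  exact (hΦ x hx y hy).trans_lt (mul_lt_of_lt_one_left hpos hη)

/-- A map which differs from the identity by a contraction is a bijection of a ball, and so does
its inverse. -/
theorem exists_inverse_of_perturbation [CompleteSpace K] {Φ : K → K} {r η : ℝ} (hη0 : 0 ≤ η)
    (hη : η < 1) (hr : 0 ≤ r) (h0 : Φ 0 = 0)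
    (hΦ : ∀ x ∈ Metric.closedBall (0 : K) r, ∀ y ∈ Metric.closedBall (0 : K) r,
      ‖(Φ x - x) - (Φ y - y)‖ ≤ η * ‖x - y‖) :
    Set.MapsTo Φ (Metric.closedBall 0 r) (Metric.closedBall 0 r) ∧
    ∃ Ψ : K → K, Set.MapsTo Ψ (Metric.closedBall 0 r) (Metric.closedBall 0 r) ∧
      Set.InvOn Ψ Φ (Metric.closedBall 0 r) (Metric.closedBall 0 r) ∧
      ∀ x ∈ Metric.closedBall (0 : K) r, ∀ y ∈ Metric.closedBall (0 : K) r,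
        ‖(Ψ x - x) - (Ψ y - y)‖ ≤ η * ‖x - y‖ := by
  set B := Metric.closedBall (0 : K) r with hB
  have hmem0 : (0 : K) ∈ B := Metric.mem_closedBall_self hr
  have hiso : ∀ x ∈ B, ∀ y ∈ B, ‖Φ x - Φ y‖ = ‖x - y‖ :=
    fun x hx y hy => norm_sub_eq_of_perturbation hη hΦ hx hy
  have hmaps : Set.MapsTo Φ B B := by
    intro x hx
    have h := hiso x hx 0 hmem0
    rw [h0, sub_zero, sub_zero] at h
    rw [hB, mem_closedBall_zero_iff] at hx ⊢
    rwa [h]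
  have hsurj : Set.SurjOn Φ B B := by
    intro y hy
    -- A fixed point of this contraction is a preimage of y.
    have hst : Set.MapsTo (fun x => y - (Φ x - x)) B B := by
      intro x hx
      have h1 := hmaps hx
      rw [hB, mem_closedBall_zero_iff] at *
      exact norm_sub_le_of_le hy (norm_sub_le_of_le h1 hx)
    have hc : ContractingWith ⟨η, hη0⟩ (hst.restrict _ B B) := by
      refine ⟨by exact_mod_cast hη, LipschitzWith.of_dist_le_mul fun u v => ?_⟩
      rw [Subtype.dist_eq, Subtype.dist_eq, dist_eq_norm, dist_eq_norm]
      simp only [Set.MapsTo.val_restrict_apply]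
      rw [sub_sub_sub_cancel_left, norm_sub_rev u.1]
      exact hΦ _ v.2 _ u.2
    obtain ⟨x, hx, hfix, -⟩ := hc.exists_fixedPoint' Metric.isClosed_closedBall.isComplete hst
      hmem0 (edist_ne_top _ _)
    refine ⟨x, hx, ?_⟩
    have h : y - (Φ x - x) = x := hfix
    linear_combination -h
  have hinj : Set.InjOn Φ B := by
    intro x hx y hy hxy
    have h := hiso x hx y hy
    rw [hxy, sub_self, norm_zero] at h
    exact sub_eq_zero.mp (norm_eq_zero.mp h.symm)
  have hinv : Set.InvOn (Function.invFunOn Φ B) Φ B B := Set.BijOn.invOn_invFunOn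
    ⟨hmaps, hinj, hsurj⟩
  have hΨ : Set.MapsTo (Function.invFunOn Φ B) B B := hsurj.mapsTo_invFunOn
  refine ⟨hmaps, Function.invFunOn Φ B, hΨ, hinv, fun x hx y hy => ?_⟩
  have h1 := hΦ _ (hΨ hx) _ (hΨ hy)
  have h2 := hiso _ (hΨ hx) _ (hΨ hy)
  rw [hinv.2 hx, hinv.2 hy] at h1 h2
  rw [← h2] at h1
  rwa [← norm_neg, show -(Function.invFunOn Φ B x - x - (Function.invFunOn Φ B y - y))
    = x - Function.invFunOn Φ B x - (y - Function.invFunOn Φ B y) by ring]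

end Perturbation

/-! ### Gluing the interpolated orbits over a partition into balls. -/

section Gluing

variable {K : Type*} [NormedField K]

/-- Every orbit of `f` starting at a point `x₀` of norm at most `r` is interpolated by a nearly
affine function of slope `a * x₀ ^ (m + 1)`. -/
def OrbitsInterpolated (f : K → K) (m : ℕ) (a : K) (r η : ℝ) : Prop :=
  ∀ x₀ : K, ‖x₀‖ ≤ r → ∃ H : K → K, H 0 = x₀ ∧
    (∀ t u, ‖t‖ ≤ 1 → ‖u‖ ≤ 1 →
      ‖(H t - t * (a * x₀ ^ (m + 1))) - (H u - u * (a * x₀ ^ (m + 1)))‖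
        ≤ η * ‖a * x₀ ^ (m + 1)‖ * ‖t - u‖) ∧
    ∀ t, ‖t‖ ≤ 1 → H (t + 1) = f (H t)

/-- The ball around `x` of radius `|a x ^ (m + 1)|`. -/
def orbitBall (m : ℕ) (a x : K) : Set K := Metric.closedBall x ‖a * x ^ (m + 1)‖

/-- A point of `orbitBall m a x` which depends on this ball only. -/
noncomputable def orbitCenter (m : ℕ) (a x : K) : K :=
  Classical.epsilon fun y => y ∈ orbitBall m a x

/-- The locally constant translation by `a x ^ (m + 1)`, for `x` the centre of the ball. -/
noncomputable def orbitShift (m : ℕ) (a x : K) : K := x + a * orbitCenter m a x ^ (m + 1)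

theorem self_mem_orbitBall (m : ℕ) (a x : K) : x ∈ orbitBall m a x :=
  Metric.mem_closedBall_self (norm_nonneg _)

theorem orbitCenter_mem (m : ℕ) (a x : K) : orbitCenter m a x ∈ orbitBall m a x :=
  Classical.epsilon_spec (p := fun y => y ∈ orbitBall m a x) ⟨x, self_mem_orbitBall m a x⟩

theorem orbitCenter_zero (m : ℕ) (a : K) : orbitCenter m a 0 = 0 := by
  simpa [orbitBall] using orbitCenter_mem m a 0

variable [IsUltrametricDist K] {m : ℕ} {a : K} {r : ℝ}

/-- The radius |a||x|^(m+1) is smaller than |x| when x ≠ 0, so the norm, and with it the radius, is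
constant on each ball. This is why the balls form a partition. -/
theorem norm_eq_of_mem_orbitBall (hr : ‖a‖ * r ^ m < 1) {x y : K} (hx : ‖x‖ ≤ r)
    (hy : y ∈ orbitBall m a x) : ‖y‖ = ‖x‖ := by
  rcases eq_or_ne x 0 with rfl | hx0
  · simp [orbitBall] at hy
    simp [hy]
  have hpos : 0 < ‖x‖ := norm_pos_iff.mpr hx0
  refine norm_eq_of_norm_sub_lt ?_
  rw [orbitBall, Metric.mem_closedBall, dist_eq_norm, norm_sub_rev] at hy
  refine hy.trans_lt ?_
  rw [norm_mul, norm_pow, pow_succ, ← mul_assoc]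
  refine mul_lt_of_lt_one_left hpos (lt_of_le_of_lt ?_ hr)
  gcongr

theorem orbitBall_eq_of_mem (hr : ‖a‖ * r ^ m < 1) {x y : K} (hx : ‖x‖ ≤ r)
    (hy : y ∈ orbitBall m a x) : orbitBall m a y = orbitBall m a x := by
  have h : ‖a * y ^ (m + 1)‖ = ‖a * x ^ (m + 1)‖ := by
    rw [norm_mul, norm_mul, norm_pow, norm_pow, norm_eq_of_mem_orbitBall hr hx hy]
  rw [orbitBall, h]
  exact (IsUltrametricDist.closedBall_eq_of_mem hy).symm

theorem orbitCenter_eq_of_mem (hr : ‖a‖ * r ^ m < 1) {x y : K} (hx : ‖x‖ ≤ r)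
    (hy : y ∈ orbitBall m a x) : orbitCenter m a y = orbitCenter m a x := by
  rw [orbitCenter, orbitBall_eq_of_mem hr hx hy, orbitCenter]

theorem norm_orbitCenter (hr : ‖a‖ * r ^ m < 1) {x : K} (hx : ‖x‖ ≤ r) :
    ‖orbitCenter m a x‖ = ‖x‖ :=
  norm_eq_of_mem_orbitBall hr hx (orbitCenter_mem m a x)

theorem orbitShift_mem (hr : ‖a‖ * r ^ m < 1) {x : K} (hx : ‖x‖ ≤ r) :
    orbitShift m a x ∈ orbitBall m a x := by
  rw [orbitBall, Metric.mem_closedBall, dist_eq_norm, orbitShift, add_sub_cancel_left, norm_mul,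
    norm_mul, norm_pow, norm_pow, norm_orbitCenter hr hx]

/-- Gluing the interpolations of the orbits: `f` is conjugate to `orbitShift m a`. -/
theorem OrbitsInterpolated.exists_conjugation {f : K → K} {η : ℝ}
    (hf : OrbitsInterpolated f m a r η) (hη0 : 0 ≤ η) (hr : ‖a‖ * r ^ m < 1) (ha : a ≠ 0)
    (hr0 : 0 ≤ r) :
    ∃ Φ : K → K, Φ 0 = 0 ∧
      (∀ x, ‖x‖ ≤ r → ‖Φ x - x‖ ≤ η * (‖a‖ * ‖x‖ ^ (m + 1))) ∧
      (∀ x, ‖x‖ ≤ r → ∀ y, ‖y‖ ≤ r → ‖(Φ x - x) - (Φ y - y)‖ ≤ η * ‖x - y‖) ∧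
      ∀ x, ‖x‖ ≤ r → Φ (orbitShift m a x) = f (Φ x) := by
  have hf' : ∀ x₀ : K, ∃ H : K → K, ‖x₀‖ ≤ r → H 0 = x₀ ∧
    (∀ t u, ‖t‖ ≤ 1 → ‖u‖ ≤ 1 →
      ‖(H t - t * (a * x₀ ^ (m + 1))) - (H u - u * (a * x₀ ^ (m + 1)))‖
        ≤ η * ‖a * x₀ ^ (m + 1)‖ * ‖t - u‖) ∧
    ∀ t, ‖t‖ ≤ 1 → H (t + 1) = f (H t) := by
    intro x₀
    by_cases h : ‖x₀‖ ≤ r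
    · obtain ⟨H, hH⟩ := hf x₀ h
      exact ⟨H, fun _ => hH⟩
    · exact ⟨id, fun h' => absurd h' h⟩
  choose H hH using hf'
  -- `A` is the step of the translation on the ball of x, and `τ` the time coordinate with x =
  -- centre + `τ` · `A`. At 0 the ball is a point and `τ` is 0/0 = 0.
  let A : K → K := fun x => a * orbitCenter m a x ^ (m + 1)
  let τ : K → K := fun x => (x - orbitCenter m a x) / A x
  let Φ : K → K := fun x => H (orbitCenter m a x) (τ x)
  have hc : ∀ x, ‖x‖ ≤ r → ‖orbitCenter m a x‖ ≤ r := fun x hx =>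
    (norm_orbitCenter hr hx).trans_le hx
  have hA : ∀ x, ‖x‖ ≤ r → ‖A x‖ = ‖a‖ * ‖x‖ ^ (m + 1) := by
    intro x hx
    rw [norm_mul, norm_pow, norm_orbitCenter hr hx]
  have hA0 : ∀ x, ‖x‖ ≤ r → x ≠ 0 → A x ≠ 0 := by
    intro x hx hx0
    rw [← norm_ne_zero_iff, hA x hx]
    have := norm_ne_zero_iff.mpr hx0
    have := norm_ne_zero_iff.mpr ha
    positivity
  have hdist : ∀ x, ‖x‖ ≤ r → ‖x - orbitCenter m a x‖ ≤ ‖A x‖ := by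
    intro x hx
    have := orbitCenter_mem m a x
    rwa [orbitBall, Metric.mem_closedBall, dist_eq_norm, norm_sub_rev, norm_mul, norm_pow,
      ← hA x hx] at this
  have hτ : ∀ x, ‖x‖ ≤ r → ‖τ x‖ ≤ 1 := by
    intro x hx
    rw [norm_div]
    exact div_le_one_of_le₀ (hdist x hx) (norm_nonneg _)
  have hτA : ∀ x, ‖x‖ ≤ r → τ x * A x = x - orbitCenter m a x := by
    intro x hx
    rcases eq_or_ne x 0 with rfl | hx0
    · simp [τ, orbitCenter_zero]
    · exact div_mul_cancel₀ _ (hA0 x hx hx0)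
  have hsame : ∀ x, ‖x‖ ≤ r → ∀ y ∈ orbitBall m a x, ‖(Φ x - x) - (Φ y - y)‖ ≤ η * ‖x - y‖ := by
    intro x hx y hy
    have hyr : ‖y‖ ≤ r := (norm_eq_of_mem_orbitBall hr hx hy).trans_le hx
    have hcy := orbitCenter_eq_of_mem hr hx hy
    have hAy : A y = A x := by simp only [A, hcy]
    obtain ⟨-, h, -⟩ := hH (orbitCenter m a x) (hc x hx)
    have h1 := h (τ x) (τ y) (hτ x hx) (hτ y hyr)
    have hx1 := hτA x hx
    have hy1 := hτA y hyr
    rw [hAy, hcy] at hy1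
    have h2 : ‖A x‖ * ‖τ x - τ y‖ = ‖x - y‖ := by
      rw [← norm_mul]
      congr 1
      linear_combination hx1 - hy1
    rw [mul_assoc, show ‖a * orbitCenter m a x ^ (m + 1)‖ = ‖A x‖ from rfl, h2] at h1
    have hΦy : Φ y = H (orbitCenter m a x) (τ y) := by simp only [Φ, hcy]
    rw [hΦy]
    convert h1 using 2
    simp only [Φ]
    linear_combination hx1 - hy1
  have hcenter : ∀ x, ‖x‖ ≤ r → Φ (orbitCenter m a x) = orbitCenter m a x := by
    intro x hx
    have h : orbitCenter m a (orbitCenter m a x) = orbitCenter m a x :=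
      orbitCenter_eq_of_mem hr hx (orbitCenter_mem m a x)
    simp only [Φ, τ, h, sub_self, zero_div]
    exact (hH _ (hc x hx)).1
  have hsmall : ∀ x, ‖x‖ ≤ r → ‖Φ x - x‖ ≤ η * (‖a‖ * ‖x‖ ^ (m + 1)) := by
    intro x hx
    have h := hsame x hx _ (orbitCenter_mem m a x)
    rw [hcenter x hx, sub_self, sub_zero] at h
    rw [← hA x hx]
    exact h.trans (mul_le_mul_of_nonneg_left (hdist x hx) hη0)
  refine ⟨Φ, ?_, hsmall, ?_, ?_⟩
  · have h := hcenter 0 (by simpa using hr0)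
    rwa [orbitCenter_zero] at h
  · intro x hx y hy
    by_cases hxy : y ∈ orbitBall m a x
    · exact hsame x hx y hxy
    -- Points in different balls are farther apart than both radii, and each displacement is at most
    -- η times its own radius.
    · have hyx : x ∉ orbitBall m a y := fun h => hxy (by
        rw [orbitBall_eq_of_mem hr hy h]
        exact self_mem_orbitBall m a y)
      rw [orbitBall, Metric.mem_closedBall, not_le, dist_eq_norm, norm_mul, norm_pow] at hxy hyx
      rw [norm_sub_rev] at hxy
      refine norm_sub_le_of_le ((hsmall x hx).trans ?_) ((hsmall y hy).trans ?_)
      · exact mul_le_mul_of_nonneg_left hxy.le hη0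
      · exact mul_le_mul_of_nonneg_left hyx.le hη0
  · intro x hx
    have hcs := orbitCenter_eq_of_mem hr hx (orbitShift_mem hr hx)
    rcases eq_or_ne x 0 with rfl | hx0
    -- At 0 the slope vanishes, so the affine estimate forces H 1 = H 0 = 0, that is, f 0 = 0.
    · have h0 := (hH (orbitCenter m a 0) (hc 0 hx)).2.2 0 (by simp)
      have hc0 := hcenter 0 hx
      have hAx : A 0 = 0 := by simp [A, orbitCenter_zero]
      have hs : orbitShift m a 0 = 0 := by simp [orbitShift, orbitCenter_zero]
      have hz := (hH (orbitCenter m a 0) (hc 0 hx)).1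
      have h1 := (hH (orbitCenter m a 0) (hc 0 hx)).2.1 1 0 (by simp) (by simp)
      rw [orbitCenter_zero] at *
      rw [hs, hc0]
      simp only [ne_eq, Nat.add_eq_zero_iff, one_ne_zero, and_false, not_false_eq_true, zero_pow,
        mul_zero, sub_zero, norm_zero, zero_mul, norm_le_zero_iff, sub_eq_zero] at h1
      rw [zero_add, h1, hz] at h0
      exact h0
    · have hstep : τ (orbitShift m a x) = τ x + 1 := by
        have hAs : A (orbitShift m a x) = A x := by simp only [A, hcs]
        have := hA0 x hx hx0
        simp only [τ, hAs, hcs]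
        rw [orbitShift]
        change (x + A x - orbitCenter m a x) / A x = _
        field_simp
        ring
      simp only [Φ, hcs, hstep]
      exact (hH _ (hc x hx)).2.2 _ (hτ x hx)

end Gluing

/-! ### From the common model to a conjugation between two maps. -/

section Conjugation

variable {K : Type*} [NormedField K]

theorem isLipeomorphism_of_isometry {h k : K → K} {U V : Set K} (hU : Set.MapsTo h U V)
    (hV : Set.MapsTo k V U) (hinv : Set.InvOn k h U V)
    (hiso : ∀ x ∈ U, ∀ y ∈ U, ‖h x - h y‖ = ‖x - y‖) : IsLipeomorphism h k U V := by
  refine ⟨hU, hV, hinv, ⟨1, ?_⟩, ⟨1, ?_⟩⟩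
  · refine LipschitzOnWith.of_dist_le_mul fun x hx y hy => ?_
    rw [dist_eq_norm, dist_eq_norm, hiso x hx y hy, NNReal.coe_one, one_mul]
  · refine LipschitzOnWith.of_dist_le_mul fun x hx y hy => ?_
    rw [dist_eq_norm, dist_eq_norm, ← hiso _ (hV hx) _ (hV hy), hinv.2 hx, hinv.2 hy,
      NNReal.coe_one, one_mul]

variable [CompleteSpace K] [IsUltrametricDist K]

/-- The inverse of a conjugation to `orbitShift m a`, and the resulting invariance of the ball. -/
theorem OrbitsInterpolated.exists_bijective_conjugation {f : K → K} {m : ℕ} {a : K} {r η : ℝ}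
    (hf : OrbitsInterpolated f m a r η) (hη0 : 0 ≤ η) (hη : η < 1) (hr : ‖a‖ * r ^ m < 1)
    (ha : a ≠ 0) (hr0 : 0 ≤ r) :
    ∃ Φ Ψ : K → K, Φ 0 = 0 ∧
      Set.MapsTo f (Metric.closedBall 0 r) (Metric.closedBall 0 r) ∧
      Set.MapsTo Φ (Metric.closedBall 0 r) (Metric.closedBall 0 r) ∧
      Set.MapsTo Ψ (Metric.closedBall 0 r) (Metric.closedBall 0 r) ∧
      Set.InvOn Ψ Φ (Metric.closedBall 0 r) (Metric.closedBall 0 r) ∧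
      (∀ x ∈ Metric.closedBall (0 : K) r, ‖Φ x - x‖ ≤ η * (‖a‖ * ‖x‖ ^ (m + 1))) ∧
      (∀ x ∈ Metric.closedBall (0 : K) r, ∀ y ∈ Metric.closedBall (0 : K) r,
        ‖(Φ x - x) - (Φ y - y)‖ ≤ η * ‖x - y‖) ∧
      (∀ x ∈ Metric.closedBall (0 : K) r, ∀ y ∈ Metric.closedBall (0 : K) r,
        ‖(Ψ x - x) - (Ψ y - y)‖ ≤ η * ‖x - y‖) ∧
      ∀ x ∈ Metric.closedBall (0 : K) r, Φ (orbitShift m a x) = f (Φ x) := by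
  obtain ⟨Φ, h0, hsmall, hlip, hconj⟩ := hf.exists_conjugation hη0 hr ha hr0
  have hball : ∀ x ∈ Metric.closedBall (0 : K) r, ‖x‖ ≤ r := fun x => mem_closedBall_zero_iff.mp
  replace hsmall := fun x hx => hsmall x (hball x hx)
  replace hlip := fun x hx y hy => hlip x (hball x hx) y (hball y hy)
  replace hconj := fun x hx => hconj x (hball x hx)
  obtain ⟨hmaps, Ψ, hΨ, hinv, hΨlip⟩ := exists_inverse_of_perturbation hη0 hη hr0 h0 hlip
  refine ⟨Φ, Ψ, h0, fun x hx => ?_, hmaps, hΨ, hinv, hsmall, hlip, hΨlip, hconj⟩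
  -- On the ball, f is Φ ∘ shift ∘ Ψ, and the shift preserves norms.
  have h := hconj _ (hΨ hx)
  rw [hinv.2 hx] at h
  rw [← h]
  have hx' := hΨ hx
  refine hmaps ?_
  rw [mem_closedBall_zero_iff] at hx' ⊢
  rwa [norm_eq_of_mem_orbitBall hr hx' (orbitShift_mem hr hx')]

/-- Two maps whose orbits are interpolated with the same slopes are conjugate by an isometry. -/
theorem OrbitsInterpolated.exists_lipeomorphism {f g : K → K} {m : ℕ} {a : K} {r η : ℝ}
    (hf : OrbitsInterpolated f m a r η) (hg : OrbitsInterpolated g m a r η) (hη0 : 0 ≤ η)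
    (hη : η < 1) (hr : ‖a‖ * r ^ m < 1) (ha : a ≠ 0) (hr0 : 0 ≤ r) :
    Set.MapsTo f (Metric.closedBall 0 r) (Metric.closedBall 0 r) ∧
    Set.MapsTo g (Metric.closedBall 0 r) (Metric.closedBall 0 r) ∧
    ∃ h k : K → K,
      IsLipeomorphism h k (Metric.closedBall 0 r) (Metric.closedBall 0 r) ∧ h 0 = 0 ∧
      (∀ x ∈ Metric.closedBall (0 : K) r, ∀ y ∈ Metric.closedBall (0 : K) r,
        ‖h x - h y‖ = ‖x - y‖) ∧
      (∀ x ∈ Metric.closedBall (0 : K) r, f (h x) = h (g x)) ∧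
      (∀ x ∈ Metric.closedBall (0 : K) r, ‖h x - x‖ ≤ ‖a‖ * ‖x‖ ^ (m + 1)) ∧
      (∀ x ∈ Metric.closedBall (0 : K) r, ∀ y ∈ Metric.closedBall (0 : K) r,
        ‖(h x - x) - (h y - y)‖ ≤ η * ‖x - y‖) ∧
      (∀ x ∈ Metric.closedBall (0 : K) r, ∀ y ∈ Metric.closedBall (0 : K) r,
        ‖(k x - x) - (k y - y)‖ ≤ η * ‖x - y‖) := by
  obtain ⟨Φ, Φi, hΦ0, hfB, hΦ, hΦi, hΦinv, hΦs, hΦl, hΦil, hΦc⟩ :=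
    hf.exists_bijective_conjugation hη0 hη hr ha hr0
  obtain ⟨Ψ, Ψi, hΨ0, hgB, hΨ, hΨi, hΨinv, hΨs, hΨl, hΨil, hΨc⟩ :=
    hg.exists_bijective_conjugation hη0 hη hr ha hr0
  set B := Metric.closedBall (0 : K) r with hB
  have hmem0 : (0 : K) ∈ B := Metric.mem_closedBall_self hr0
  have hΨi0 : Ψi 0 = 0 := by
    have := hΨinv.1 hmem0
    rwa [hΨ0] at this
  have hiso {u : K → K} (hu : ∀ x ∈ B, ∀ y ∈ B, ‖(u x - x) - (u y - y)‖ ≤ η * ‖x - y‖) :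
      ∀ x ∈ B, ∀ y ∈ B, ‖u x - u y‖ = ‖x - y‖ :=
    fun x hx y hy => norm_sub_eq_of_perturbation hη hu hx hy
  -- u∘v - id = (u - id)∘v + (v - id), and v is an isometry; by the ultrametric inequality
  -- composition does not worsen η.
  have hcomp {u v : K → K} (hv : Set.MapsTo v B B)
      (hul : ∀ x ∈ B, ∀ y ∈ B, ‖(u x - x) - (u y - y)‖ ≤ η * ‖x - y‖)
      (hvl : ∀ x ∈ B, ∀ y ∈ B, ‖(v x - x) - (v y - y)‖ ≤ η * ‖x - y‖) :
      ∀ x ∈ B, ∀ y ∈ B, ‖(u (v x) - x) - (u (v y) - y)‖ ≤ η * ‖x - y‖ := by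
    intro x hx y hy
    rw [show (u (v x) - x) - (u (v y) - y)
      = ((u (v x) - v x) - (u (v y) - v y)) + ((v x - x) - (v y - y)) by ring]
    refine norm_add_le_of_le ?_ (hvl x hx y hy)
    rw [← hiso hvl x hx y hy]
    exact hul _ (hv hx) _ (hv hy)
  have hhl := hcomp hΨi hΦl hΨil
  have hhiso := hiso (u := fun x => Φ (Ψi x)) hhl
  refine ⟨hfB, hgB, fun x => Φ (Ψi x), fun x => Ψ (Φi x), ?_, ?_, hhiso, ?_, ?_, hhl,
    hcomp hΦi hΨl hΦil⟩
  · refine isLipeomorphism_of_isometry (hΦ.comp hΨi) (hΨ.comp hΦi) ⟨?_, ?_⟩ hhiso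
    · intro x hx
      simp only
      rw [hΦinv.1 (hΨi hx), hΨinv.2 hx]
    · intro x hx
      simp only
      rw [hΨinv.1 (hΦi hx), hΦinv.2 hx]
  · simp only [hΨi0, hΦ0]
  · intro x hx
    have h1 := hΨc _ (hΨi hx)
    rw [hΨinv.2 hx] at h1
    have hx' := hΨi hx
    have hsB : orbitShift m a (Ψi x) ∈ B := by
      rw [hB, mem_closedBall_zero_iff] at hx' ⊢
      rwa [norm_eq_of_mem_orbitBall hr hx' (orbitShift_mem hr hx')]
    simp only
    rw [← hΦc _ hx', ← h1, hΨinv.1 hsB]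
  · intro x hx
    have hx' := hΨi hx
    have hn : ‖Ψi x‖ = ‖x‖ := by simpa [hΨi0] using hiso hΨil x hx 0 hmem0
    have hη1 : η * (‖a‖ * ‖x‖ ^ (m + 1)) ≤ ‖a‖ * ‖x‖ ^ (m + 1) :=
      mul_le_of_le_one_left (by positivity) hη.le
    have h1 := (hΦs _ hx').trans_eq (by rw [hn])
    have h2 := (hΨs _ hx').trans_eq (by rw [hn])
    rw [hΨinv.2 hx] at h2
    simp only
    -- Both terms are displacements, under Φ and under Ψ, of the same point `Ψi x`, whose norm is
    -- that of x.
    rw [show Φ (Ψi x) - x = (Φ (Ψi x) - Ψi x) - (x - Ψi x) by ring]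
    exact (norm_sub_le_of_le h1 h2).trans hη1

end Conjugation

/-! ### Radius of convergence and coefficient bounds. -/

section Radius

variable {K : Type*} [NormedField K]

theorem exists_norm_coeff_mul_pow_le {F : K⟦X⟧} (hF : 0 < radius F) :
    ∃ s : ℝ≥0, 0 < s ∧ (s : ℝ≥0∞) < radius F ∧ ∃ M : ℝ, ∀ n, ‖coeff n F‖ * (s : ℝ) ^ n ≤ M := by
  obtain ⟨s, hs0, hs⟩ := ENNReal.lt_iff_exists_nnreal_btwn.mp hF
  have hs0 : 0 < s := by exact_mod_cast hs0
  refine ⟨s, hs0, hs, ?_⟩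
  rw [radius, ENNReal.lt_inv_iff_lt_inv] at hs
  have hev : ∀ᶠ n in atTop, ‖coeff n F‖ * (s : ℝ) ^ n ≤ 1 := by
    filter_upwards [eventually_lt_of_limsup_lt hs, eventually_gt_atTop 0] with n hn hn0
    have hn0' : (n : ℝ) ≠ 0 := by exact_mod_cast hn0.ne'
    have h1 := ENNReal.rpow_le_rpow hn.le (Nat.cast_nonneg (α := ℝ) n)
    rw [← ENNReal.rpow_mul, one_div_mul_cancel hn0', ENNReal.rpow_one, ENNReal.rpow_natCast,
      ← ENNReal.coe_inv hs0.ne', ← ENNReal.coe_pow, ENNReal.coe_le_coe, ← NNReal.coe_le_coe] at h1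
    push_cast at h1
    have hs' : (0 : ℝ) < (s : ℝ) ^ n := by positivity
    calc _ ≤ ((s : ℝ)⁻¹) ^ n * (s : ℝ) ^ n := by gcongr
      _ = 1 := by rw [← mul_pow, inv_mul_cancel₀ (by positivity), one_pow]
  obtain ⟨M, hM⟩ := (isBoundedUnder_of_eventually_le hev).bddAbove_range
  exact ⟨M, fun n => hM ⟨n, rfl⟩⟩

theorem inv_le_radius {F : K⟦X⟧} {C : ℝ≥0} (hF : ∀ n, ‖coeff n F‖ ≤ (C : ℝ) ^ n) :
    (C : ℝ≥0∞)⁻¹ ≤ radius F := by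
  rw [radius, ENNReal.inv_le_inv]
  refine limsup_le_of_le (by isBoundedDefault) ?_
  filter_upwards [eventually_gt_atTop 0] with n hn
  have hn' : (n : ℝ) ≠ 0 := by exact_mod_cast hn.ne'
  have h1 : (‖coeff n F‖₊ : ℝ≥0∞) ≤ (C : ℝ≥0∞) ^ n := by exact_mod_cast hF n
  calc _ ≤ ((C : ℝ≥0∞) ^ n) ^ (1 / (n : ℝ)) := by gcongr
    _ = C := by
      rw [← ENNReal.rpow_natCast, ← ENNReal.rpow_mul, mul_one_div_cancel hn', ENNReal.rpow_one]

theorem summable_norm_of_le {F : K⟦X⟧} {s M : ℝ} (hs : 0 < s)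
    (hM : ∀ n, ‖coeff n F‖ * s ^ n ≤ M) {x : K} (hx : ‖x‖ < s) :
    Summable fun n => ‖coeff n F * x ^ n‖ := by
  have hq : ‖x‖ / s < 1 := (div_lt_one hs).mpr hx
  refine Summable.of_nonneg_of_le (fun _ => norm_nonneg _) (fun n => ?_)
    ((summable_geometric_of_lt_one (by positivity) hq).mul_left M)
  calc ‖coeff n F * x ^ n‖ = ‖coeff n F‖ * s ^ n * (‖x‖ / s) ^ n := by
        have := (pow_pos hs n).ne'
        rw [norm_mul, norm_pow, div_pow]
        field_simp
    _ ≤ _ := by gcongr; exact hM n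

end Radius

/-! ### Tangent series satisfy the interpolation hypothesis near 0. -/

section Tangent

variable {K : Type*} [NormedField K] [CompleteSpace K] [IsUltrametricDist K] [CharZero K]

/-- The orbits of a tangent series near `0` are interpolated. -/
theorem orbitsInterpolated_of_bounds {p : ℕ} (hp : p.Prime) (hpK : ‖(p : K)‖ < 1) {F : K⟦X⟧}
    {m : ℕ} (hm : 1 ≤ m) {a : K} (hF : IsTangentSeries F m a) {r η : ℝ} (hη0 : 0 ≤ η) (hη : η < 1)
    (hsum : ∀ u : K, ‖u‖ ≤ r → Summable fun n => coeff n F * u ^ n)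
    (htail : ∀ ρ : ℝ, 0 ≤ ρ → ρ ≤ r → ∀ n, m + 2 ≤ n →
      ‖coeff n F‖ * ρ ^ n ≤ η * (‖a‖ * ρ ^ (m + 1)))
    (hr : ‖a‖ * r ^ m ≤ η * ‖(p : K)‖) : OrbitsInterpolated (evalAt F) m a r η := by
  intro x₀ hx₀
  let c : ℕ → K := fun n => coeff n F - if n = 1 then 1 else 0
  have hc0 : ∀ n ≤ m, c n = 0 := by
    rintro (_ | _ | n) hn
    · simp [c, -coeff_zero_eq_constantCoeff, hF.coeff_zero]
    · simp [c, hF.coeff_one]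
    · simp [c, hF.coeff_between (n + 2) (by omega) hn]
  have hcm : c (m + 1) = a := by
    simp [c, hF.coeff_lead, show m ≠ 0 by omega]
  have hcn : ∀ n, m + 2 ≤ n → c n = coeff n F := by
    intro n hn
    simp [c, show n ≠ 1 by omega]
  have hc : ∀ j, ‖c j‖ * ‖x₀‖ ^ j ≤ ‖a‖ * ‖x₀‖ ^ m * ‖x₀‖ := by
    intro j
    rw [mul_assoc, ← pow_succ]
    rcases lt_trichotomy j (m + 1) with hj | rfl | hj
    · rw [hc0 j (by omega), norm_zero, zero_mul]
      positivity
    · rw [hcm]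
    · rw [hcn j hj]
      exact (htail _ (norm_nonneg _) hx₀ j hj).trans (mul_le_of_le_one_left (by positivity) hη.le)
  have hhas : ∀ u : K, ‖u‖ ≤ r → HasSum (fun j => c j * u ^ j) (evalAt F u - u) := by
    intro u hu
    have h := (hsum u hu).hasSum.sub (hasSum_ite_eq 1 u)
    refine h.congr_fun fun j => ?_
    by_cases hj : j = 1
    · simp [c, hj, sub_mul]
    · simp [c, hj]
  have heval : ∀ u : K, ‖u‖ ≤ r → evalAt F u = u + ∑' j, c j * u ^ j := by
    intro u hu
    rw [(hhas u hu).tsum_eq]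
    ring
  have hlead : ‖∑' j, c j * x₀ ^ j - a * x₀ ^ (m + 1)‖ ≤ η * ‖a * x₀ ^ (m + 1)‖ := by
    have h := (hhas x₀ hx₀).summable.hasSum.sub (hasSum_ite_eq (m + 1) (a * x₀ ^ (m + 1)))
    rw [← h.tsum_eq]
    refine IsUltrametricDist.norm_tsum_le_of_forall_le_of_nonneg (by positivity) fun j => ?_
    rcases lt_trichotomy j (m + 1) with hj | rfl | hj
    · rw [hc0 j (by omega), if_neg hj.ne]
      simp
      positivity
    · rw [hcm, if_pos rfl, sub_self, norm_zero]
      positivity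
    · rw [hcn j hj, if_neg hj.ne', sub_zero, norm_mul, norm_mul, norm_pow, norm_pow]
      exact htail _ (norm_nonneg _) hx₀ j hj
  -- Taking ρ = |x₀| rather than r gives qρ = |a x₀^(m+1)|, so the error is relative to the slope of
  -- this very orbit.
  obtain ⟨H, hH0, hHρ, hlip, hstep⟩ := exists_interpolation hp hpK (c := c) (ρ := ‖x₀‖)
    (q := ‖a‖ * ‖x₀‖ ^ m) (η := η) (by positivity) hη (le_trans (by gcongr) hr) hc
    (fun u hu => (hhas u (hu.trans hx₀)).summable) le_rfl
  refine ⟨H, hH0, fun t u ht hu => ?_, fun t ht => ?_⟩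
  · rw [show (H t - t * (a * x₀ ^ (m + 1))) - (H u - u * (a * x₀ ^ (m + 1)))
      = ((H t - t * ∑' j, c j * x₀ ^ j) - (H u - u * ∑' j, c j * x₀ ^ j))
        + (∑' j, c j * x₀ ^ j - a * x₀ ^ (m + 1)) * (t - u) by ring]
    refine norm_add_le_of_le ((hlip t u ht hu).trans_eq ?_) ?_
    · rw [norm_mul, norm_pow]
      ring
    · rw [norm_mul]
      gcongr
  · rw [hstep t ht, heval _ ((hHρ t ht).trans hx₀)]

theorem IsTangentSeries.eventually_orbitsInterpolated {p : ℕ} (hp : p.Prime)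
    (hpK : ‖(p : K)‖ < 1) {F : K⟦X⟧} {m : ℕ} (hm : 1 ≤ m) {a : K} (ha : a ≠ 0)
    (hF : IsTangentSeries F m a) {η : ℝ} (hη0 : 0 < η) (hη : η < 1) :
    ∀ᶠ r in 𝓝[>] (0 : ℝ), Metric.closedBall 0 r ⊆ disk F ∧ ‖a‖ * r ^ m < 1 ∧
      OrbitsInterpolated (evalAt F) m a r η := by
  obtain ⟨s, hs0, hs, M, hM⟩ := exists_norm_coeff_mul_pow_le hF.radius_pos
  have hs0 : (0 : ℝ) < s := hs0
  have hp0 : 0 < ‖(p : K)‖ := by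
    rw [norm_pos_iff]
    exact_mod_cast hp.ne_zero
  have ha0 : 0 < ‖a‖ := norm_pos_iff.mpr ha
  have hM0 : 0 ≤ M := le_trans (by positivity) (hM 0)
  have e1 : ∀ᶠ r : ℝ in 𝓝[>] (0 : ℝ), r < (s : ℝ) :=
    (eventually_lt_nhds hs0).filter_mono nhdsWithin_le_nhds
  -- Makes every term of degree at least m + 2 at most η times the leading one; `e3` below is the
  -- condition q ≤ η|p|.
  have e2 : ∀ᶠ r in 𝓝[>] (0 : ℝ), M * r ≤ η * ‖a‖ * (s : ℝ) ^ (m + 2) := by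
    have h : Tendsto (fun r : ℝ => M * r) (𝓝 0) (𝓝 0) := by
      simpa using (tendsto_id (α := ℝ) (x := 𝓝 0)).const_mul M
    exact (h.eventually_le_const (by positivity)).filter_mono nhdsWithin_le_nhds
  have e3 : ∀ᶠ r in 𝓝[>] (0 : ℝ), ‖a‖ * r ^ m ≤ η * ‖(p : K)‖ := by
    have h : Tendsto (fun r : ℝ => ‖a‖ * r ^ m) (𝓝 0) (𝓝 0) := by
      have := ((continuous_pow m).tendsto (0 : ℝ)).const_mul ‖a‖
      rwa [zero_pow (by omega), mul_zero] at this
    exact (h.eventually_le_const (by positivity)).filter_mono nhdsWithin_le_nhds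
  filter_upwards [e1, e2, e3, self_mem_nhdsWithin] with r h1 h2 h3 (hr0 : 0 < r)
  refine ⟨fun x hx => ?_, h3.trans_lt ?_, ?_⟩
  · have hxs : ‖x‖₊ < s := by
      rw [← NNReal.coe_lt_coe, coe_nnnorm]
      exact (mem_closedBall_zero_iff.mp hx).trans_lt h1
    exact lt_trans (by exact_mod_cast hxs) hs
  · exact mul_lt_one_of_nonneg_of_lt_one_left hη0.le hη hpK.le
  · refine orbitsInterpolated_of_bounds hp hpK hm hF hη0.le hη
      (fun u hu => (summable_norm_of_le hs0 hM (hu.trans_lt h1)).of_norm) ?_ h3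
    intro ρ hρ0 hρ n hn
    have hq : ρ / s ≤ 1 := (div_le_one hs0).mpr (hρ.trans h1.le)
    have hρM : M * ρ ≤ η * ‖a‖ * (s : ℝ) ^ (m + 2) := le_trans (by gcongr) h2
    have hsn : (s : ℝ) ^ n ≠ 0 := (pow_pos hs0 n).ne'
    calc ‖coeff n F‖ * ρ ^ n
        = ‖coeff n F‖ * (s : ℝ) ^ n * (ρ / s) ^ n := by rw [div_pow]; field_simp
      _ ≤ M * (ρ / s) ^ n := by gcongr; exact hM n
      _ ≤ M * (ρ / s) ^ (m + 2) := by
        gcongr M * ?_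
        exact pow_le_pow_of_le_one (by positivity) hq hn
      _ = M * ρ * (ρ ^ (m + 1) / (s : ℝ) ^ (m + 2)) := by rw [div_pow]; ring
      _ ≤ η * ‖a‖ * (s : ℝ) ^ (m + 2) * (ρ ^ (m + 1) / (s : ℝ) ^ (m + 2)) := by gcongr
      _ = _ := by field_simp

end Tangent

/-! ### Evaluation and inversion of power series. -/

section Evaluation

variable {K : Type*} [NormedField K]

theorem evalAt_X_mul {F : K⟦X⟧} {x : K} (hF : Summable fun n => coeff n F * x ^ n) :
    evalAt (X * F) x = x * evalAt F x := by
  have hs : ∀ n, coeff (n + 1) (X * F) * x ^ (n + 1) = x * (coeff n F * x ^ n) := by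
    intro n
    rw [coeff_succ_X_mul, pow_succ]
    ring
  have hsum : Summable fun n => coeff n (X * F) * x ^ n := by
    rw [← summable_nat_add_iff 1]
    simp only [hs]
    exact hF.mul_left x
  rw [evalAt, hsum.tsum_eq_zero_add]
  simp only [hs]
  rw [tsum_mul_left, evalAt]
  simp

theorem evalAt_mul_evalAt_inv [CompleteSpace K] {F : K⟦X⟧} (h0 : coeff 0 F = 1) {x : K}
    (hF : Summable fun n => ‖coeff n F * x ^ n‖)
    (hFi : Summable fun n => ‖coeff n F⁻¹ * x ^ n‖) : evalAt F x * evalAt F⁻¹ x = 1 := by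
  have hne : constantCoeff F ≠ 0 := by
    rw [← coeff_zero_eq_constantCoeff_apply, h0]
    exact one_ne_zero
  rw [evalAt, evalAt, tsum_mul_tsum_eq_tsum_sum_antidiagonal_of_summable_norm hF hFi]
  have h : ∀ n, ∑ kl ∈ Finset.HasAntidiagonal.antidiagonal n,
      coeff kl.1 F * x ^ kl.1 * (coeff kl.2 F⁻¹ * x ^ kl.2)
      = coeff n (1 : K⟦X⟧) * x ^ n := by
    intro n
    rw [← PowerSeries.mul_inv_cancel _ hne, coeff_mul, Finset.sum_mul]
    refine Finset.sum_congr rfl fun kl hkl => ?_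
    rw [← Finset.HasAntidiagonal.mem_antidiagonal.mp hkl, pow_add]
    ring
  simp only [h]
  rw [tsum_eq_single 0 fun n hn => by rw [coeff_one, if_neg hn, zero_mul]]
  simp

theorem exists_rootSeries_inv_eq [CharZero K] (m : ℕ) (hm : m ≠ 0) (a : K) :
    ∃ U : K⟦X⟧, (rootSeries m a)⁻¹ = 1 + X ^ m * U ∧ coeff 0 U = a := by
  have h0 := rootSeries_coeff_zero m a
  have hdvd : (X : K⟦X⟧) ^ m ∣ rootSeries m a - 1 := by
    rw [X_pow_dvd_iff]
    intro n hn
    rcases Nat.eq_zero_or_pos n with rfl | hn0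
    · rw [map_sub, h0]
      simp
    · rw [map_sub, rootSeries_coeff_between m a n hn0 hn, coeff_one, if_neg hn0.ne', sub_zero]
  obtain ⟨V, hV⟩ := hdvd
  have hV0 : coeff 0 V = -a := by
    have h := congrArg (coeff m) hV
    rw [map_sub, rootSeries_coeff_self m hm a, coeff_one, if_neg hm, sub_zero] at h
    have h' := coeff_X_pow_mul V m 0
    rw [zero_add] at h'
    rw [h, h']
  have hne : constantCoeff (rootSeries m a) ≠ 0 := by
    rw [← coeff_zero_eq_constantCoeff_apply, h0]
    exact one_ne_zero
  have hinv := PowerSeries.mul_inv_cancel _ hne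
  refine ⟨-V * (rootSeries m a)⁻¹, ?_, ?_⟩
  · have : rootSeries m a = 1 + X ^ m * V := by rw [← hV]; ring
    linear_combination hinv - (rootSeries m a)⁻¹ * this
  · rw [coeff_zero_eq_constantCoeff_apply] at *
    rw [map_mul, map_neg, hV0, PowerSeries.constantCoeff_inv, h0]
    simp

/-- The geometric growth of the coefficients is inherited by the inverse of a power series. -/
theorem norm_coeff_inv_le [IsUltrametricDist K] {F : K⟦X⟧} {C : ℝ} (hC : 0 ≤ C) (h0 : coeff 0 F = 1)
    (hF : ∀ n, ‖coeff n F‖ ≤ C ^ n) (n : ℕ) : ‖coeff n F⁻¹‖ ≤ C ^ n := by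
  rw [coeff_zero_eq_constantCoeff_apply] at h0
  induction n using Nat.strong_induction_on with
  | _ n ih =>
    rw [PowerSeries.coeff_inv, h0]
    split_ifs with hn
    · simp [hn]
    · rw [inv_one, neg_one_mul, norm_neg]
      refine IsUltrametricDist.norm_sum_le_of_forall_le_of_nonneg (by positivity) fun x hx => ?_
      rw [Finset.HasAntidiagonal.mem_antidiagonal] at hx
      split_ifs with hlt
      · rw [norm_mul, ← hx, pow_add]
        exact mul_le_mul (hF _) (ih _ hlt) (norm_nonneg _) (by positivity)
      · rw [norm_zero]
        positivity

end Evaluation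

/-! ### The flow as the sum of a tangent series. -/

section Flow

variable {K : Type*} [NormedField K] [IsUltrametricDist K] [CharZero K]

/-- Clearing denominators leaves the integer ∏ (1 - i m) over i < k. The bound thus holds even when
p divides m. -/
theorem norm_eval_descPochhammer_inv_mul_pow_le {m : ℕ} (hm : m ≠ 0) (k : ℕ) :
    ‖(descPochhammer K k).eval ((m : K)⁻¹) * (m : K) ^ k‖ ≤ 1 := by
  have hm' : (m : K) ≠ 0 := by exact_mod_cast hm
  induction k with
  | zero => simp
  | succ k ih =>
    have h : (descPochhammer K (k + 1)).eval ((m : K)⁻¹) * (m : K) ^ (k + 1)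
        = (descPochhammer K k).eval ((m : K)⁻¹) * (m : K) ^ k * (1 - (k * m : ℕ)) := by
      rw [descPochhammer_succ_eval]
      push_cast
      linear_combination (Polynomial.eval ((m : K)⁻¹) (descPochhammer K k)) * (m : K) ^ k *
        inv_mul_cancel₀ hm'
    rw [h, norm_mul]
    exact mul_le_one₀ ih (norm_nonneg _)
      (norm_sub_le_of_le norm_one.le (IsUltrametricDist.norm_natCast_le_one K _))

theorem norm_choose_inv_mul_pow_le {p : ℕ} (hp : p.Prime) (hpK : ‖(p : K)‖ < 1) {m : ℕ}
    (hm : m ≠ 0) (a : K) (k : ℕ) :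
    ‖Ring.choose ((m : K)⁻¹) k * (-(a * (m : K))) ^ k‖ ≤ (‖a‖ / ‖(p : K)‖) ^ k := by
  have hp0 : 0 < ‖(p : K)‖ := by
    rw [norm_pos_iff]
    exact_mod_cast hp.ne_zero
  have hk : 0 < ‖(k.factorial : K)‖ := by
    rw [norm_pos_iff]
    exact_mod_cast k.factorial_ne_zero
  have hchoose : Ring.choose ((m : K)⁻¹) k
      = (k.factorial : K)⁻¹ * (descPochhammer K k).eval ((m : K)⁻¹) := by
    rw [Ring.choose_eq_smul, smul_eq_mul, ← descPochhammer_map (algebraMap ℤ K),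
      Polynomial.eval_map, ← Polynomial.aeval_def, Polynomial.aeval_eq_smeval]
  have h : Ring.choose ((m : K)⁻¹) k * (-(a * (m : K))) ^ k
      = (-a) ^ k * (k.factorial : K)⁻¹ *
        ((descPochhammer K k).eval ((m : K)⁻¹) * (m : K) ^ k) := by
    rw [hchoose, ← neg_mul, mul_pow]
    ring
  rw [h, norm_mul]
  refine (mul_le_of_le_one_right (norm_nonneg _)
    (norm_eval_descPochhammer_inv_mul_pow_le hm k)).trans ?_
  rw [norm_mul, norm_pow, norm_neg, norm_inv, div_pow, div_eq_mul_inv]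
  gcongr
  exact pow_le_norm_factorial hp hpK k

theorem exists_norm_coeff_rootSeries_le {p : ℕ} (hp : p.Prime) (hpK : ‖(p : K)‖ < 1) {m : ℕ}
    (hm : m ≠ 0) (a : K) : ∃ C : ℝ≥0, 1 ≤ C ∧ ∀ n, ‖coeff n (rootSeries m a)‖ ≤ (C : ℝ) ^ n := by
  let b : ℝ≥0 := ‖a‖₊ / ‖(p : K)‖₊
  -- The maximum with 1 allows the exponent n / m to be raised to n.
  refine ⟨max 1 b, le_max_left _ _, fun n => ?_⟩
  have hb : (‖a‖ / ‖(p : K)‖ : ℝ) ≤ (max 1 b : ℝ≥0) := by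
    have : b ≤ max 1 b := le_max_right _ _
    exact_mod_cast this
  have h1 : (1 : ℝ) ≤ (max 1 b : ℝ≥0) := by exact_mod_cast le_max_left 1 b
  rw [rootSeries, coeff_mk]
  split_ifs with h
  · calc _ ≤ (‖a‖ / ‖(p : K)‖) ^ (n / m) := norm_choose_inv_mul_pow_le hp hpK hm a _
      _ ≤ ((max 1 b : ℝ≥0) : ℝ) ^ (n / m) := by gcongr
      _ ≤ _ := pow_le_pow_right₀ h1 (Nat.div_le_self n m)
  · rw [norm_zero]
    positivity

theorem isTangentSeries_X_mul_rootSeries_inv {m : ℕ} (hm : m ≠ 0) (a : K) {C : ℝ≥0} (hC : 1 ≤ C)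
    (hroot : ∀ n, ‖coeff n (rootSeries m a)‖ ≤ (C : ℝ) ^ n) :
    IsTangentSeries (X * (rootSeries m a)⁻¹) m a := by
  have hinv := norm_coeff_inv_le C.2 (rootSeries_coeff_zero m a) hroot
  obtain ⟨U, hU, hU0⟩ := exists_rootSeries_inv_eq m hm a
  have hX : ∀ n, coeff (n + 1) (X * (rootSeries m a)⁻¹) = coeff n (rootSeries m a)⁻¹ :=
    fun n => by rw [coeff_succ_X_mul]
  refine ⟨?_, ?_, ?_, ?_, ?_⟩
  · refine lt_of_lt_of_le ?_ (inv_le_radius (C := C) ?_)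
    · simp
    · rintro (_ | n)
      · simp
      · rw [hX]
        exact (hinv n).trans (pow_le_pow_right₀ (by exact_mod_cast hC) n.le_succ)
  · simp
  · rw [hX 0, hU]
    simp [hm]
  · intro n hn hnm
    obtain ⟨n, rfl⟩ : ∃ l, n = l + 1 := ⟨n - 1, by omega⟩
    rw [hX, hU, map_add, coeff_X_pow_mul', if_neg (by omega), coeff_one, if_neg (by omega),
      add_zero]
  · rw [hX, hU, map_add, coeff_X_pow_mul', if_pos le_rfl, coeff_one, if_neg hm, Nat.sub_self, hU0,
      zero_add]

variable [CompleteSpace K]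

/-- Near `0`, the flow is given by a tangent series. -/
theorem exists_tangentSeries_eq_flow {p : ℕ} (hp : p.Prime) (hpK : ‖(p : K)‖ < 1) {m : ℕ}
    (hm : m ≠ 0) (a : K) : ∃ G : K⟦X⟧, IsTangentSeries G m a ∧
      ∀ᶠ r in 𝓝[>] (0 : ℝ), ∀ x ∈ Metric.closedBall (0 : K) r,
        x ∈ flowDomain m a ∧ flow m a x = evalAt G x := by
  obtain ⟨C, hC, hroot⟩ := exists_norm_coeff_rootSeries_le hp hpK hm a
  have hinv := norm_coeff_inv_le C.2 (rootSeries_coeff_zero m a) hroot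
  refine ⟨_, isTangentSeries_X_mul_rootSeries_inv hm a hC hroot, ?_⟩
  have hC0 : 0 < C := zero_lt_one.trans_le hC
  have hCr : (0 : ℝ) < (C : ℝ)⁻¹ := inv_pos.mpr hC0
  have e : ∀ᶠ r : ℝ in 𝓝[>] (0 : ℝ), r < (C : ℝ)⁻¹ :=
    (eventually_lt_nhds hCr).filter_mono nhdsWithin_le_nhds
  filter_upwards [e] with r hr x hx
  have hxC : ‖x‖ < (C : ℝ)⁻¹ := (mem_closedBall_zero_iff.mp hx).trans_lt hr
  have hbound : ∀ F : K⟦X⟧, (∀ n, ‖coeff n F‖ ≤ (C : ℝ) ^ n) →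
      Summable fun n => ‖coeff n F * x ^ n‖ := by
    intro F hF
    refine summable_norm_of_le hCr (M := 1) (fun n => ?_) hxC
    calc _ ≤ (C : ℝ) ^ n * (C : ℝ)⁻¹ ^ n := by gcongr; exact hF n
      _ = 1 := by rw [← mul_pow, mul_inv_cancel₀ (inv_pos.mp hCr).ne', one_pow]
  have hmul := evalAt_mul_evalAt_inv (rootSeries_coeff_zero m a) (hbound _ hroot) (hbound _ hinv)
  have hne := left_ne_zero_of_mul_eq_one hmul
  refine ⟨⟨?_, hne⟩, ?_⟩
  · refine lt_of_lt_of_le ?_ (inv_le_radius hroot)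
    rw [← ENNReal.coe_inv hC0.ne', ENNReal.coe_lt_coe, ← NNReal.coe_lt_coe]
    simpa using hxC
  · rw [evalAt_X_mul (hbound _ hinv).of_norm, flow, div_eq_mul_inv,
      ← eq_inv_of_mul_eq_one_right hmul]

end Flow

/-! ### Assembly of the equivalence and of the quantitative estimates. -/

section Main

variable {K : Type*} [NormedField K] [CompleteSpace K] [IsUltrametricDist K] [CharZero K]

/-- The displacement is really of size |a||x|^(m+1); the loss of ε in the exponent absorbs the
constant. -/
theorem eventually_mul_pow_le_rpow {m : ℕ} (C : ℝ) {ε : ℝ} (hε : 0 < ε) :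
    ∀ᶠ r in 𝓝[>] (0 : ℝ), ∀ t : ℝ, 0 < t → t ≤ r →
      C * t ^ (m + 1) ≤ t ^ ((m : ℝ) + 1 - ε) := by
  have h : Tendsto (fun r : ℝ => |C| * r ^ ε) (𝓝 0) (𝓝 0) := by
    have := ((Real.continuousAt_rpow_const 0 ε (Or.inr hε.le)).tendsto).const_mul |C|
    rwa [Real.zero_rpow hε.ne', mul_zero] at this
  filter_upwards [(h.eventually_le_const zero_lt_one).filter_mono nhdsWithin_le_nhds]
    with r hr t ht0 htr
  have ht : 0 ≤ t := ht0.le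
  have h1 : t ^ (m + 1) = t ^ ((m : ℝ) + 1 - ε) * t ^ ε := by
    rw [← Real.rpow_add ht0, ← Real.rpow_natCast]
    congr 1
    push_cast
    ring
  have h2 : C * t ^ ε ≤ 1 := by
    refine le_trans ?_ hr
    gcongr
    exact le_abs_self C
  calc C * t ^ (m + 1) = t ^ ((m : ℝ) + 1 - ε) * (C * t ^ ε) := by rw [h1]; ring
    _ ≤ t ^ ((m : ℝ) + 1 - ε) * 1 := by gcongr
    _ = _ := mul_one _

theorem lipeomorphicallyEquivalent_of_tangent {p : ℕ} (hp : p.Prime) (hpK : ‖(p : K)‖ < 1) {m : ℕ}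
    (hm : 1 ≤ m) {a : K} (ha : a ≠ 0) {F G : K⟦X⟧} (hF : IsTangentSeries F m a)
    (hG : IsTangentSeries G m a) : LipeomorphicallyEquivalent (evalAt F) (evalAt G) := by
  obtain ⟨r, ⟨-, hr, hf⟩, ⟨-, -, hg⟩, hr0⟩ :=
    ((hF.eventually_orbitsInterpolated hp hpK hm ha one_half_pos one_half_lt_one).and
      ((hG.eventually_orbitsInterpolated hp hpK hm ha one_half_pos one_half_lt_one).and
        self_mem_nhdsWithin)).exists
  have hr0 : 0 < r := hr0
  obtain ⟨-, -, h, k, hl, h0, -, hconj, -⟩ :=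
    hf.exists_lipeomorphism hg one_half_pos.le one_half_lt_one hr ha hr0.le
  have hB := Metric.closedBall_mem_nhds (0 : K) hr0
  exact ⟨_, hB, _, hB, h, k, hl, h0, by filter_upwards [hB] with x hx using hconj x hx⟩

end Main

end PadicGerm

theorem theorem1p1 {K : Type*} [NormedField K] [CompleteSpace K] [IsUltrametricDist K]
    [CharZero K] (p : ℕ) (hp : p.Prime) (hpK : ‖(p : K)‖ < 1)
    (m : ℕ) (hm : 1 ≤ m) (a : K) (ha : a ≠ 0) :
    (∀ F : PowerSeries K, PadicGerm.IsTangentSeries F m a →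
      PadicGerm.LipeomorphicallyEquivalent (PadicGerm.evalAt F) (PadicGerm.flow m a) ∧
      ∀ ε δ : ℝ, 0 < ε → 0 < δ → δ < 1 / 2 →
        ∃ X' ∈ 𝓝 (0 : K), ∃ h k : K → K,
          -- both maps are defined on `X'` and leave it invariant
          X' ⊆ PadicGerm.disk F ∧ X' ⊆ PadicGerm.flowDomain m a ∧
          Set.MapsTo (PadicGerm.evalAt F) X' X' ∧ Set.MapsTo (PadicGerm.flow m a) X' X' ∧
          -- `h` is a bijective lipeomorphism of `X'` with inverse `k`, and an isometry
          PadicGerm.IsLipeomorphism h k X' X' ∧ h 0 = 0 ∧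
          (∀ x ∈ X', ∀ y ∈ X', ‖h x - h y‖ = ‖x - y‖) ∧
          -- `h` conjugates the two maps
          (∀ x ∈ X', k (PadicGerm.evalAt F (h x)) = PadicGerm.flow m a x) ∧
          -- estimates for `h - id` and `h⁻¹ - id`
          (∀ x ∈ X', ‖h x - x‖ ≤ ‖x‖ ^ ((m : ℝ) + 1 - ε)) ∧
          (∀ x ∈ X', ∀ y ∈ X', ‖(h x - x) - (h y - y)‖ ≤ δ * ‖x - y‖) ∧
          (∀ x ∈ X', ∀ y ∈ X', ‖(k x - x) - (k y - y)‖ ≤ δ * ‖x - y‖)) ∧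
    (∀ F G : PowerSeries K, PadicGerm.IsTangentSeries F m a → PadicGerm.IsTangentSeries G m a →
      PadicGerm.LipeomorphicallyEquivalent (PadicGerm.evalAt F) (PadicGerm.evalAt G)) := by
  refine ⟨fun F hF => ?_, fun F G hF hG =>
    PadicGerm.lipeomorphicallyEquivalent_of_tangent hp hpK hm ha hF hG⟩
  obtain ⟨G, hG, hflow⟩ := PadicGerm.exists_tangentSeries_eq_flow hp hpK (by omega : m ≠ 0) a
  refine ⟨?_, fun ε δ hε hδ hδ2 => ?_⟩
  · obtain ⟨U, hU, V, hV, h, k, hl, h0, hconj⟩ :=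
      PadicGerm.lipeomorphicallyEquivalent_of_tangent hp hpK hm ha hF hG
    refine ⟨U, hU, V, hV, h, k, hl, h0, ?_⟩
    obtain ⟨r, hr, hr0⟩ := (hflow.and self_mem_nhdsWithin).exists
    filter_upwards [hconj, Metric.closedBall_mem_nhds (0 : K) hr0] with x hx hxr
    rw [hx, (hr x hxr).2]
  · have hδ1 : δ < 1 := by linarith
    obtain ⟨r, ⟨hdisk, hr, hf⟩, ⟨-, -, hg⟩, hfl, hpow, hr0⟩ :=
      ((hF.eventually_orbitsInterpolated hp hpK hm ha hδ hδ1).and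
        ((hG.eventually_orbitsInterpolated hp hpK hm ha hδ hδ1).and (hflow.and
          ((PadicGerm.eventually_mul_pow_le_rpow (m := m) ‖a‖ hε).and
            self_mem_nhdsWithin)))).exists
    have hr0 : 0 < r := hr0
    obtain ⟨hfB, hgB, h, k, hl, h0, hiso, hconj, hsmall, hhl, hkl⟩ :=
      hf.exists_lipeomorphism hg hδ.le hδ1 hr ha hr0.le
    have hflB : Set.MapsTo (PadicGerm.flow m a) (Metric.closedBall 0 r)
        (Metric.closedBall 0 r) := fun x hx => by
      rw [(hfl x hx).2]
      exact hgB hx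
    refine ⟨_, Metric.closedBall_mem_nhds 0 hr0, h, k, hdisk, fun x hx => (hfl x hx).1, hfB, hflB,
      hl, h0, hiso, fun x hx => ?_, fun x hx => ?_, hhl, hkl⟩
    · rw [hconj x hx, (hfl x hx).2, hl.invOn.1 (hgB hx)]
    · rcases eq_or_ne x 0 with rfl | hx0
      -- At 0 the left side vanishes and a real power of 0 is nonnegative, whatever the sign of the
      -- exponent.
      · rw [h0, sub_zero, norm_zero]
        positivity
      · exact (hsmall x hx).trans (hpow _ (norm_pos_iff.mpr hx0)
          (mem_closedBall_zero_iff.mp hx))
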